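/- Let $\mathbb{K}$ be a field of characteristic zero, $q$ an indeterminate, and let $U=U_q(\mathfrak{sl}_2\times\mathfrak{sl}_2)$ be the quantised enveloping algebra over $\mathbb{K}(q)$ with generators $E_i,F_i,K_i^{\pm1}$ ($i=1,2$), subject to the relations that the $K_i$ commute, $K_iE_jK_i^{-1}=q^{2\delta_{ij}}E_j$, $K_iF_jK_i^{-1}=q^{-2\delta_{ij}}F_j$, $E_iF_j-F_jE_i=\delta_{ij}\frac{K_i-K_i^{-1}}{q-q^{-1}}$, $E_1E_2=E_2E_1$ and $F_1F_2=F_2F_1$. Let $u\mapsto\overline{u}$ be the bar involution of $U$, that is, the $\mathbb{K}$-algebra automorphism with $\overline{q}=q^{-1}$, $\overline{E_i}=E_i$, $\overline{F_i}=F_i$, $\overline{K_i}=K_i^{-1}$. Let $U^+$ be the subalgebra generated by $E_1,E_2$, with weight spaces $U^+_\mu$ for $\mu\in Q^+=\mathbb{N}_0\alpha_1\oplus\mathbb{N}_0\alpha_2$. Let $\mathscr{U}$ be the algebra of natural endomorphisms of the forgetful functor from finite-dimensional $U$-modules of type $1$ to $\mathbb{K}(q)$-vector spaces; both $U$ and $\prod_{\mu\in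 Q^+}U^+_\mu$ act on these modules and so map to $\mathscr{U}$. Consider the Satake diagram of type $AIII_{11}$: two unconnected white nodes $1,2$, no black nodes, and the diagram automorphism $\tau$ that interchanges $1$ and $2$; put $\Theta(\alpha_i)=-\alpha_{\tau(i)}$ and $s(1)=s(2)=1$, $\mathbf{s}=(0,0)$. Let $c_1,c_2\in\mathbb{K}(q)^\times$ satisfy $c_1=c_2$ and $c_{\tau(i)}=\overline{c_i}$ for $i=1,2$. Let $B_{\mathbf c}\subset U$ be the $\mathbb{K}(q)$-subalgebra generated by $U^0_\Theta=\langle K_\lambda\mid\lambda\in Q,\ \Theta(\lambda)=\lambda\rangle$ and $B_i=F_i-c_iE_{\tau(i)}K_i^{-1}$ for $i=1,2$. Then there is a unique $\mathbb{K}$-algebra automorphism $b\mapsto\overline{b}^B$ of $B_{\mathbf c}$ that agrees with the bar involution of $U$ on $U^0_\Theta$ and fixes $B_1$ and $B_2$. There is a unique element $\mathfrak{X}=\sum_{\mu\in Q^+}\mathfrak{X}_\mu\in\prod_{\mu\in Q^+}U^+_\mu$ (the quasi $K$-matrix) with $\mathfrak{X}_0=1$ such that $\overline{b}^B\,\mathfrak{X}=\mathfrak{X}\,\overline{b}$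 holds in $\mathscr{U}$ for all $b\in B_{\mathbf c}$. It is given by $$\mathfrak{X}=\sum_{n\ge0}\frac{(q-q^{-1})^n}{\{n\}!}\,c_1^n\,(E_1E_2)^n,$$ where $\{k\}=1+q^2+\dots+q^{2(k-1)}$ and $\{n\}!=\prod_{k=1}^n\{k\}$. -/

import Mathlib

/-! Quantum symmetric pair of type `AIII₁₁`: the Lie algebra is `sl₂ × sl₂` with Dynkin diagram
two unconnected nodes (indexed by `Fin 2`), no black nodes, and `τ` the swap of the two nodes. -/

universe u

noncomputable section

namespace AIII11

open Polynomial

/-! ### The ground field `𝕂(q)` -/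

/-- The indeterminate `q` of the field `𝕂(q)` of rational functions. -/
abbrev q (𝕂 : Type u) [Field 𝕂] : RatFunc 𝕂 := RatFunc.X

lemma q_ne_zero (𝕂 : Type u) [Field 𝕂] : q 𝕂 ≠ 0 := RatFunc.X_ne_zero

lemma q_pow_ne_one (𝕂 : Type u) [Field 𝕂] {n : ℕ} (hn : n ≠ 0) : q 𝕂 ^ n ≠ 1 := by
  intro h
  have h1 : (algebraMap 𝕂[X] (RatFunc 𝕂)) (X ^ n) = algebraMap 𝕂[X] (RatFunc 𝕂) 1 := by
    rw [map_pow, RatFunc.algebraMap_X, map_one]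
    exact h
  have h2 : (X ^ n : 𝕂[X]) = 1 := RatFunc.algebraMap_injective 𝕂 h1
  have h3 := congrArg natDegree h2
  rw [natDegree_X_pow, natDegree_one] at h3
  exact hn h3

lemma q_zpow_injective (𝕂 : Type u) [Field 𝕂] : Function.Injective (fun n : ℤ => q 𝕂 ^ n) := by
  have key : ∀ n : ℤ, q 𝕂 ^ n = 1 → n = 0 := by
    intro n hn
    by_contra h0
    rcases Int.natAbs_eq n with h | h
    · rw [h, zpow_natCast] at hn
      exact q_pow_ne_one 𝕂 (Int.natAbs_ne_zero.2 h0) hn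
    · rw [h, zpow_neg, zpow_natCast, inv_eq_one] at hn
      exact q_pow_ne_one 𝕂 (Int.natAbs_ne_zero.2 h0) hn
  intro m n h
  have h' : q 𝕂 ^ m = q 𝕂 ^ n := h
  have : q 𝕂 ^ (m - n) = 1 := by
    rw [zpow_sub₀ (q_ne_zero 𝕂), h', div_self (zpow_ne_zero _ (q_ne_zero 𝕂))]
  have := key _ this
  omega

lemma aeval_q_inv_injective (𝕂 : Type u) [Field 𝕂] :
    Function.Injective (aeval (R := 𝕂) (q 𝕂)⁻¹) := by
  have h : Transcendental 𝕂 (q 𝕂) := by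
    rw [transcendental_iff]
    intro p hp
    rw [RatFunc.aeval_X_left_eq_algebraMap] at hp
    exact RatFunc.algebraMap_injective 𝕂 (by rw [hp, map_zero])
  have h' : Transcendental 𝕂 (q 𝕂)⁻¹ := fun ha => h (by simpa using ha.inv)
  exact transcendental_iff_injective.1 h'

/-- The bar involution `f(q) ↦ f(q⁻¹)` of `𝕂(q)`. -/
def barQ (𝕂 : Type u) [Field 𝕂] : RatFunc 𝕂 →ₐ[𝕂] RatFunc 𝕂 :=
  RatFunc.liftAlgHom (aeval (q 𝕂)⁻¹)
    (nonZeroDivisors_le_comap_nonZeroDivisors_of_injective _ (aeval_q_inv_injective 𝕂))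

@[simp] lemma barQ_q (𝕂 : Type u) [Field 𝕂] : barQ 𝕂 (q 𝕂) = (q 𝕂)⁻¹ := by
  have h : ∀ p : 𝕂[X], barQ 𝕂 (algebraMap 𝕂[X] (RatFunc 𝕂) p) = aeval (q 𝕂)⁻¹ p := by
    intro p
    have := RatFunc.liftAlgHom_apply_div' (aeval (R := 𝕂) (q 𝕂)⁻¹)
      (nonZeroDivisors_le_comap_nonZeroDivisors_of_injective _ (aeval_q_inv_injective 𝕂)) p 1
    simpa [barQ] using this
  simpa using h X

/-! ### The quantised enveloping algebra -/

/-- The Cartan matrix of `sl₂ × sl₂`; it is also the matrix of the form `(αᵢ, αⱼ)`. -/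
def cartan (i j : Fin 2) : ℤ := if i = j then 2 else 0

/-- Generators `Eᵢ, Fᵢ, Kᵢ, Kᵢ⁻¹`. -/
inductive Gen : Type
  | E (i : Fin 2)
  | F (i : Fin 2)
  | K (i : Fin 2)
  | Kinv (i : Fin 2)

/-- The free algebra on the generators. -/
abbrev Free (𝕂 : Type u) [Field 𝕂] : Type u := FreeAlgebra (RatFunc 𝕂) Gen

/-- The generator `g` in the free algebra. -/
abbrev gen (𝕂 : Type u) [Field 𝕂] (g : Gen) : Free 𝕂 := FreeAlgebra.ι (RatFunc 𝕂) g

open Gen in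
/-- The defining relations of `U_q(sl₂ × sl₂)`. The quantum Serre relations for a pair `i ≠ j` with
`a_{ij} = 0` say that `Eᵢ, Eⱼ` commute and that `Fᵢ, Fⱼ` commute. -/
inductive Rel (𝕂 : Type u) [Field 𝕂] : Free 𝕂 → Free 𝕂 → Prop
  | K_mul_Kinv (i : Fin 2) : Rel 𝕂 (gen 𝕂 (K i) * gen 𝕂 (Kinv i)) 1
  | Kinv_mul_K (i : Fin 2) : Rel 𝕂 (gen 𝕂 (Kinv i) * gen 𝕂 (K i)) 1
  | K_comm (i j : Fin 2) : Rel 𝕂 (gen 𝕂 (K i) * gen 𝕂 (K j)) (gen 𝕂 (K j) * gen 𝕂 (K i))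
  | K_E (i j : Fin 2) : Rel 𝕂 (gen 𝕂 (K i) * gen 𝕂 (E j) * gen 𝕂 (Kinv i))
      (q 𝕂 ^ cartan i j • gen 𝕂 (E j))
  | K_F (i j : Fin 2) : Rel 𝕂 (gen 𝕂 (K i) * gen 𝕂 (F j) * gen 𝕂 (Kinv i))
      (q 𝕂 ^ (-cartan i j) • gen 𝕂 (F j))
  | E_F_same (i : Fin 2) : Rel 𝕂 (gen 𝕂 (E i) * gen 𝕂 (F i) - gen 𝕂 (F i) * gen 𝕂 (E i))
      ((q 𝕂 - (q 𝕂)⁻¹)⁻¹ • (gen 𝕂 (K i) - gen 𝕂 (Kinv i)))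
  | E_F_ne (i j : Fin 2) (h : i ≠ j) :
      Rel 𝕂 (gen 𝕂 (E i) * gen 𝕂 (F j) - gen 𝕂 (F j) * gen 𝕂 (E i)) 0
  | serre_E (i j : Fin 2) (h : i ≠ j) :
      Rel 𝕂 (gen 𝕂 (E i) * gen 𝕂 (E j) - gen 𝕂 (E j) * gen 𝕂 (E i)) 0
  | serre_F (i j : Fin 2) (h : i ≠ j) :
      Rel 𝕂 (gen 𝕂 (F i) * gen 𝕂 (F j) - gen 𝕂 (F j) * gen 𝕂 (F i)) 0

/-- The quantised enveloping algebra `U = U_q(sl₂ × sl₂)` over `𝕂(q)`. -/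
def U (𝕂 : Type u) [Field 𝕂] : Type u := RingQuot (Rel 𝕂)

instance (𝕂 : Type u) [Field 𝕂] : Ring (U 𝕂) := inferInstanceAs (Ring (RingQuot (Rel 𝕂)))

instance (𝕂 : Type u) [Field 𝕂] : Algebra (RatFunc 𝕂) (U 𝕂) :=
  inferInstanceAs (Algebra (RatFunc 𝕂) (RingQuot (Rel 𝕂)))

instance (𝕂 : Type u) [Field 𝕂] : Algebra 𝕂 (U 𝕂) :=
  Algebra.compHom (U 𝕂) (algebraMap 𝕂 (RatFunc 𝕂))

instance (𝕂 : Type u) [Field 𝕂] : IsScalarTower 𝕂 (RatFunc 𝕂) (U 𝕂) :=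
  IsScalarTower.of_algebraMap_eq fun _ => rfl

/-- The projection from the free algebra to `U`. -/
def proj (𝕂 : Type u) [Field 𝕂] : Free 𝕂 →ₐ[RatFunc 𝕂] U 𝕂 :=
  RingQuot.mkAlgHom (RatFunc 𝕂) (Rel 𝕂)

lemma proj_rel (𝕂 : Type u) [Field 𝕂] {x y : Free 𝕂} (h : Rel 𝕂 x y) :
    proj 𝕂 x = proj 𝕂 y :=
  RingQuot.mkAlgHom_rel _ h

/-- The universal property of `U`. -/
def liftU (𝕂 : Type u) [Field 𝕂] {A : Type*} [Ring A] [Algebra (RatFunc 𝕂) A]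
    (f : Free 𝕂 →ₐ[RatFunc 𝕂] A) (hf : ∀ ⦃x y⦄, Rel 𝕂 x y → f x = f y) :
    U 𝕂 →ₐ[RatFunc 𝕂] A :=
  RingQuot.liftAlgHom (RatFunc 𝕂) ⟨f, hf⟩

lemma liftU_proj (𝕂 : Type u) [Field 𝕂] {A : Type*} [Ring A] [Algebra (RatFunc 𝕂) A]
    (f : Free 𝕂 →ₐ[RatFunc 𝕂] A) (hf : ∀ ⦃x y⦄, Rel 𝕂 x y → f x = f y) (x : Free 𝕂) :
    liftU 𝕂 f hf (proj 𝕂 x) = f x :=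
  RingQuot.liftAlgHom_mkAlgHom_apply (RatFunc 𝕂) f hf x

/-- The image of a generator in `U`. -/
def ofGen (𝕂 : Type u) [Field 𝕂] (g : Gen) : U 𝕂 := proj 𝕂 (gen 𝕂 g)

/-- `Eᵢ` -/
abbrev E (𝕂 : Type u) [Field 𝕂] (i : Fin 2) : U 𝕂 := ofGen 𝕂 (Gen.E i)

/-- `Fᵢ` -/
abbrev F (𝕂 : Type u) [Field 𝕂] (i : Fin 2) : U 𝕂 := ofGen 𝕂 (Gen.F i)

/-- The invertible element `Kᵢ`, whose inverse is the generator `Kᵢ⁻¹`. -/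
def K (𝕂 : Type u) [Field 𝕂] (i : Fin 2) : (U 𝕂)ˣ where
  val := ofGen 𝕂 (Gen.K i)
  inv := ofGen 𝕂 (Gen.Kinv i)
  val_inv := by
    rw [ofGen, ofGen, ← map_mul, proj_rel 𝕂 (Rel.K_mul_Kinv i), map_one]
  inv_val := by
    rw [ofGen, ofGen, ← map_mul, proj_rel 𝕂 (Rel.Kinv_mul_K i), map_one]

/-- `K_λ = K₁^{n₁} K₂^{n₂}` for `λ = n₁ α₁ + n₂ α₂` in the root lattice. -/
def Kroot (𝕂 : Type u) [Field 𝕂] (l : Fin 2 → ℤ) : (U 𝕂)ˣ := K 𝕂 0 ^ l 0 * K 𝕂 1 ^ l 1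

/-! ### The bar involution of `U` -/

/-- `U` with the scalars acting through `q ↦ q⁻¹`; only used to construct `barU`. -/
def TwistedU (𝕂 : Type u) [Field 𝕂] : Type u := U 𝕂

instance (𝕂 : Type u) [Field 𝕂] : Ring (TwistedU 𝕂) := inferInstanceAs (Ring (U 𝕂))

/-- The twisted algebra structure. -/
instance (𝕂 : Type u) [Field 𝕂] : Algebra (RatFunc 𝕂) (TwistedU 𝕂) :=
  RingHom.toAlgebra' (R := RatFunc 𝕂) (S := TwistedU 𝕂)
    ((algebraMap (RatFunc 𝕂) (U 𝕂)).comp (barQ 𝕂).toRingHom)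
    (fun r x => Algebra.commutes (A := U 𝕂) (barQ 𝕂 r) x)

/-- The identity map, as a ring isomorphism. -/
def toTwisted (𝕂 : Type u) [Field 𝕂] : U 𝕂 ≃+* TwistedU 𝕂 := RingEquiv.refl (U 𝕂)

/-- The images of the generators under the bar involution: `Eᵢ ↦ Eᵢ`, `Fᵢ ↦ Fᵢ`,
`Kᵢ ↦ Kᵢ⁻¹`. -/
def barGen : Gen → Gen
  | .E i => .E i
  | .F i => .F i
  | .K i => .Kinv i
  | .Kinv i => .K i

/-- The bar involution on the free algebra, followed by the projection to `U`. -/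
def barFree (𝕂 : Type u) [Field 𝕂] : Free 𝕂 →ₐ[RatFunc 𝕂] TwistedU 𝕂 :=
  FreeAlgebra.lift (RatFunc 𝕂) (fun g => toTwisted 𝕂 (ofGen 𝕂 (barGen g)))

lemma twisted_smul (𝕂 : Type u) [Field 𝕂] (r : RatFunc 𝕂) (x : U 𝕂) :
    r • toTwisted 𝕂 x = toTwisted 𝕂 (barQ 𝕂 r • x) := by
  rw [Algebra.smul_def, Algebra.smul_def, map_mul]
  rfl

lemma barFree_rel (𝕂 : Type u) [Field 𝕂] ⦃x y : Free 𝕂⦄ (h : Rel 𝕂 x y) :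
    barFree 𝕂 x = barFree 𝕂 y := by
  have hg : ∀ g : Gen, barFree 𝕂 (gen 𝕂 g) = toTwisted 𝕂 (ofGen 𝕂 (barGen g)) := fun g =>
    FreeAlgebra.lift_ι_apply _ _
  have K1 : ∀ i, ofGen 𝕂 (.K i) * ofGen 𝕂 (.Kinv i) = 1 := fun i => (K 𝕂 i).val_inv
  have K2 : ∀ i, ofGen 𝕂 (.Kinv i) * ofGen 𝕂 (.K i) = 1 := fun i => (K 𝕂 i).inv_val
  have key : ∀ (x : U 𝕂) (n : ℤ) (i : Fin 2),
      ofGen 𝕂 (.K i) * x * ofGen 𝕂 (.Kinv i) = q 𝕂 ^ n • x →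
      ofGen 𝕂 (.Kinv i) * x * ofGen 𝕂 (.K i) = (q 𝕂)⁻¹ ^ n • x := by
    intro x n i hx
    have : ofGen 𝕂 (.Kinv i) * (q 𝕂 ^ n • x) * ofGen 𝕂 (.K i) = x := by
      rw [← hx]
      calc _ = (ofGen 𝕂 (.Kinv i) * ofGen 𝕂 (.K i)) * x *
            (ofGen 𝕂 (.Kinv i) * ofGen 𝕂 (.K i)) := by noncomm_ring
        _ = x := by rw [K2, one_mul, mul_one]
    rw [mul_smul_comm, smul_mul_assoc] at this
    rw [← this, smul_smul, inv_zpow, inv_mul_cancel₀ (zpow_ne_zero _ (q_ne_zero 𝕂)), one_smul,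
      this]
  cases h with
  | K_mul_Kinv i =>
    simp only [map_mul, map_one, hg, barGen]
    rw [← map_mul, K2, map_one]
  | Kinv_mul_K i =>
    simp only [map_mul, map_one, hg, barGen]
    rw [← map_mul, K1, map_one]
  | K_comm i j =>
    simp only [map_mul, hg, barGen]
    have h : K 𝕂 i * K 𝕂 j = K 𝕂 j * K 𝕂 i := by
      ext
      have := proj_rel 𝕂 (Rel.K_comm i j)
      rw [map_mul, map_mul] at this
      exact this
    have h' := congrArg (fun u : (U 𝕂)ˣ => ((u⁻¹ : (U 𝕂)ˣ) : U 𝕂)) h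
    simp only [mul_inv_rev, Units.val_mul] at h'
    rw [← map_mul, ← map_mul]
    exact congrArg _ h'.symm
  | K_E i j =>
    have := proj_rel 𝕂 (Rel.K_E i j)
    simp only [map_mul, map_smul] at this
    simp only [map_mul, map_smul, hg, barGen, twisted_smul, map_zpow₀, barQ_q]
    rw [← map_mul, ← map_mul]
    exact congrArg (toTwisted 𝕂) (key _ _ _ this)
  | K_F i j =>
    have := proj_rel 𝕂 (Rel.K_F i j)
    simp only [map_mul, map_smul] at this
    simp only [map_mul, map_smul, hg, barGen, twisted_smul, map_zpow₀, barQ_q]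
    rw [← map_mul, ← map_mul]
    exact congrArg (toTwisted 𝕂) (key _ _ _ this)
  | E_F_same i =>
    have := proj_rel 𝕂 (Rel.E_F_same i)
    simp only [map_mul, map_sub, map_smul] at this
    simp only [map_mul, map_sub, map_smul, hg, barGen]
    simp only [← map_mul, ← map_sub]
    rw [twisted_smul, map_inv₀, map_sub (barQ 𝕂), map_inv₀, barQ_q, inv_inv]
    refine congrArg _ (Eq.trans this ?_)
    rw [← neg_sub (q 𝕂) (q 𝕂)⁻¹, inv_neg, neg_smul, ← smul_neg, neg_sub]
    rfl
  | E_F_ne i j hij =>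
    have := proj_rel 𝕂 (Rel.E_F_ne i j hij)
    simp only [map_mul, map_sub, map_zero] at this
    simp only [map_mul, map_sub, map_zero, hg, barGen]
    simp only [← map_mul, ← map_sub]
    exact (congrArg (toTwisted 𝕂) this).trans (map_zero _)
  | serre_E i j hij =>
    have := proj_rel 𝕂 (Rel.serre_E i j hij)
    simp only [map_mul, map_sub, map_zero] at this
    simp only [map_mul, map_sub, map_zero, hg, barGen]
    simp only [← map_mul, ← map_sub]
    exact (congrArg (toTwisted 𝕂) this).trans (map_zero _)
  | serre_F i j hij =>
    have := proj_rel 𝕂 (Rel.serre_F i j hij)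
    simp only [map_mul, map_sub, map_zero] at this
    simp only [map_mul, map_sub, map_zero, hg, barGen]
    simp only [← map_mul, ← map_sub]
    exact (congrArg (toTwisted 𝕂) this).trans (map_zero _)

/-- The induced algebra homomorphism out of `U`. -/
def barTwisted (𝕂 : Type u) [Field 𝕂] : U 𝕂 →ₐ[RatFunc 𝕂] TwistedU 𝕂 :=
  liftU 𝕂 (barFree 𝕂) (barFree_rel 𝕂)

/-- The bar involution of `U`, the ring homomorphism with `f ↦ barQ f` on scalars, `Eᵢ ↦ Eᵢ`,
`Fᵢ ↦ Fᵢ`, `Kᵢ ↦ Kᵢ⁻¹`. -/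
def barU (𝕂 : Type u) [Field 𝕂] : U 𝕂 →+* U 𝕂 :=
  ((toTwisted 𝕂).symm : TwistedU 𝕂 →+* U 𝕂).comp (barTwisted 𝕂 : U 𝕂 →+* TwistedU 𝕂)

@[simp] lemma barU_algebraMap (𝕂 : Type u) [Field 𝕂] (f : RatFunc 𝕂) :
    barU 𝕂 (algebraMap (RatFunc 𝕂) (U 𝕂) f) = algebraMap (RatFunc 𝕂) (U 𝕂) (barQ 𝕂 f) :=
  congrArg (toTwisted 𝕂).symm ((barTwisted 𝕂).commutes f)

@[simp] lemma barU_ofGen (𝕂 : Type u) [Field 𝕂] (g : Gen) :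
    barU 𝕂 (ofGen 𝕂 g) = ofGen 𝕂 (barGen g) :=
  congrArg (toTwisted 𝕂).symm ((liftU_proj 𝕂 (barFree 𝕂) (barFree_rel 𝕂)
    (gen 𝕂 g)).trans (FreeAlgebra.lift_ι_apply _ _))

/-! ### The positive part and its completion -/

/-- The subalgebra `U⁺` generated by `E₁, E₂`. -/
def Upos (𝕂 : Type u) [Field 𝕂] : Subalgebra (RatFunc 𝕂) (U 𝕂) :=
  Algebra.adjoin (RatFunc 𝕂) (Set.range (E 𝕂))

/-- The weight space `U⁺_μ = {x ∈ U⁺ | Kᵢ x Kᵢ⁻¹ = q^{(αᵢ, μ)} x}`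
for `μ = μ₁ α₁ + μ₂ α₂ ∈ Q⁺`, where `(αᵢ, μ) = ∑ⱼ a_{ij} μⱼ`. -/
def UposWt (𝕂 : Type u) [Field 𝕂] (m : Fin 2 → ℕ) : Submodule (RatFunc 𝕂) (U 𝕂) where
  carrier := {x | x ∈ Upos 𝕂 ∧ ∀ i, (K 𝕂 i : U 𝕂) * x * ((K 𝕂 i)⁻¹ : (U 𝕂)ˣ) =
    q 𝕂 ^ (∑ j, cartan i j * m j) • x}
  zero_mem' := by simp [zero_mem]
  add_mem' := by
    rintro x y ⟨hx, hx'⟩ ⟨hy, hy'⟩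
    refine ⟨add_mem hx hy, fun i => ?_⟩
    rw [mul_add, add_mul, hx', hy', smul_add]
  smul_mem' := by
    rintro r x ⟨hx, hx'⟩
    refine ⟨Subalgebra.smul_mem _ hx r, fun i => ?_⟩
    rw [mul_smul_comm, smul_mul_assoc, hx', smul_comm]

/-- The completion `Û⁺ = ∏_{μ ∈ Q⁺} U⁺_μ`. -/
abbrev Uhat (𝕂 : Type u) [Field 𝕂] : Type u := ∀ m : Fin 2 → ℕ, UposWt 𝕂 m

/-- The weight space `M_n = {v | Kᵢ v = q^{nᵢ} v}` of a `U`-module, for the integral weight `λ`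
with `(λ, αᵢ) = nᵢ`. -/
def weightSpace (𝕂 : Type u) [Field 𝕂] (M : Type u) [AddCommGroup M] [Module (RatFunc 𝕂) M]
    [Module (U 𝕂) M] [IsScalarTower (RatFunc 𝕂) (U 𝕂) M] (n : Fin 2 → ℤ) :
    Submodule (RatFunc 𝕂) M where
  carrier := {v | ∀ i, (K 𝕂 i : U 𝕂) • v = q 𝕂 ^ n i • v}
  zero_mem' := by simp
  add_mem' := by
    intro v w hv hw i
    rw [smul_add, smul_add, hv, hw]
  smul_mem' := by
    intro r v hv i
    rw [← algebraMap_smul (U 𝕂) r v, smul_smul, ← Algebra.commutes, mul_smul, hv,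
      algebraMap_smul, algebraMap_smul, smul_comm]

/-- The objects of `𝒪_int`: finite-dimensional `U`-modules of type 1, that is, those spanned by
weight vectors for integral weights. -/
structure IntModule (𝕂 : Type u) [Field 𝕂] : Type (u + 1) where
  carrier : Type u
  [addCommGroup : AddCommGroup carrier]
  [module : Module (RatFunc 𝕂) carrier]
  [moduleU : Module (U 𝕂) carrier]
  [isScalarTower : IsScalarTower (RatFunc 𝕂) (U 𝕂) carrier]
  [finite : Module.Finite (RatFunc 𝕂) carrier]
  type_one : ⨆ n : Fin 2 → ℤ, weightSpace 𝕂 carrier n = ⊤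

attribute [instance] IntModule.addCommGroup IntModule.module IntModule.moduleU
  IntModule.isScalarTower IntModule.finite

/-- The algebra `𝒰` of natural endomorphisms of the forgetful functor from `𝒪_int` to vector
spaces: families of linear maps `a_M : M → M` commuting with all `U`-module homomorphisms. -/
def Ucompl (𝕂 : Type u) [Field 𝕂] :
    Subalgebra (RatFunc 𝕂) (∀ M : IntModule 𝕂, Module.End (RatFunc 𝕂) M.carrier) where
  carrier := {a | ∀ (M N : IntModule 𝕂) (f : M.carrier →ₗ[U 𝕂] N.carrier) (v : M.carrier),
    f (a M v) = a N (f v)}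
  mul_mem' := by
    intro a b ha hb M N f v
    simp only [Pi.mul_apply, Module.End.mul_apply]
    rw [ha, hb]
  add_mem' := by
    intro a b ha hb M N f v
    simp only [Pi.add_apply, LinearMap.add_apply, map_add]
    rw [ha, hb]
  algebraMap_mem' := by
    intro r M N f v
    simp only [Pi.algebraMap_apply, Module.algebraMap_end_apply]
    rw [← algebraMap_smul (U 𝕂) r v, map_smul, algebraMap_smul]

/-- The canonical algebra homomorphism `U → 𝒰`. -/
def ofU (𝕂 : Type u) [Field 𝕂] : U 𝕂 →ₐ[RatFunc 𝕂] Ucompl 𝕂 :=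
  AlgHom.codRestrict
    (AlgHom.pi (R := RatFunc 𝕂) (fun M : IntModule 𝕂 =>
      Algebra.lsmul (RatFunc 𝕂) (RatFunc 𝕂) M.carrier (A := U 𝕂)))
    (Ucompl 𝕂) (fun x M N f v => by simp)

/-- An element of `Û⁺` has only finitely many components that act non-trivially on a given
module in `𝒪_int`. -/
lemma finite_support_action (𝕂 : Type u) [Field 𝕂] (M : IntModule 𝕂) :
    {m : Fin 2 → ℕ | ∃ x ∈ UposWt 𝕂 m, ∃ v : M.carrier, x • v ≠ 0}.Finite := by
  set S : Set (Fin 2 → ℤ) := {n | weightSpace 𝕂 M.carrier n ≠ ⊥} with hS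
  have hSfin : S.Finite := by
    let e : Fin 2 → Module.End (RatFunc 𝕂) M.carrier := fun i =>
      Algebra.lsmul (RatFunc 𝕂) (RatFunc 𝕂) M.carrier (A := U 𝕂) (K 𝕂 i : U 𝕂)
    have hT : ∀ i, {z : ℤ | (e i).HasEigenvalue (q 𝕂 ^ z)}.Finite := fun i =>
      Set.Finite.preimage (q_zpow_injective 𝕂).injOn (e i).finite_hasEigenvalue
    refine (Set.Finite.pi' hT).subset ?_
    intro n hn i
    obtain ⟨v, hv, hv0⟩ := (Submodule.ne_bot_iff _).1 hn
    exact Module.End.hasEigenvalue_of_hasEigenvector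
      (Module.End.hasEigenvector_iff.2 ⟨Module.End.mem_eigenspace_iff.2 (hv i), hv0⟩)
  have hfin : ((fun p : (Fin 2 → ℤ) × (Fin 2 → ℤ) => p.1 - p.2) '' (S ×ˢ S)).Finite :=
    (hSfin.prod hSfin).image _
  have hinj : Function.Injective (fun (m : Fin 2 → ℕ) (i : Fin 2) => ∑ j, cartan i j * (m j : ℤ)) := by
    intro m m' h
    funext i
    have := congrFun h i
    fin_cases i <;> simpa [cartan] using this
  refine (hfin.preimage hinj.injOn).subset ?_
  rintro m ⟨x, hx, v, hv⟩
  have : ∃ n, ∃ w ∈ weightSpace 𝕂 M.carrier n, x • w ≠ 0 := by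
    by_contra! hcon
    apply hv
    have hle : (⨆ n, weightSpace 𝕂 M.carrier n) ≤
        LinearMap.ker (Algebra.lsmul (RatFunc 𝕂) (RatFunc 𝕂) M.carrier (A := U 𝕂) x) :=
      iSup_le fun n w hw => by
        rw [LinearMap.mem_ker]
        exact hcon n w hw
    rw [M.type_one] at hle
    exact LinearMap.mem_ker.1 (hle (Submodule.mem_top (x := v)))
  obtain ⟨n, w, hw, hxw⟩ := this
  have hxw' : x • w ∈ weightSpace 𝕂 M.carrier (fun i => (∑ j, cartan i j * (m j : ℤ)) + n i) := by
    intro i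
    have h1 : (K 𝕂 i : U 𝕂) * x = (q 𝕂 ^ (∑ j, cartan i j * (m j : ℤ)) • x) * (K 𝕂 i : U 𝕂) := by
      rw [← hx.2 i]
      simp [mul_assoc]
    rw [smul_smul, h1, mul_smul, hw i, smul_assoc, zpow_add₀ (q_ne_zero 𝕂), mul_smul,
      ← algebraMap_smul (U 𝕂) (q 𝕂 ^ n i) w, smul_smul x, ← Algebra.commutes, mul_smul,
      algebraMap_smul]
  refine ⟨(fun i => (∑ j, cartan i j * (m j : ℤ)) + n i, n), ⟨?_, ?_⟩, ?_⟩
  · exact (Submodule.ne_bot_iff _).2 ⟨_, hxw', hxw⟩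
  · exact (Submodule.ne_bot_iff _).2 ⟨w, hw, fun h => hxw (by rw [h, smul_zero])⟩
  · funext i
    simp

lemma finite_support_smul (𝕂 : Type u) [Field 𝕂] (M : IntModule 𝕂) (a : Uhat 𝕂)
    (v : M.carrier) : (Function.support fun m => (a m : U 𝕂) • v).Finite :=
  (finite_support_action 𝕂 M).subset fun m hm => ⟨a m, (a m).2, v, hm⟩

/-- The canonical map `Û⁺ → 𝒰`: the element `∑_μ a_μ` acts on a module in `𝒪_int` by
`v ↦ ∑_μ a_μ v`, a finite sum. -/
def ofUhat (𝕂 : Type u) [Field 𝕂] (a : Uhat 𝕂) : Ucompl 𝕂 where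
  val M :=
    { toFun := fun v => ∑ᶠ m, (a m : U 𝕂) • v
      map_add' := fun v w => by
        simp only [smul_add]
        exact finsum_add_distrib (finite_support_smul 𝕂 M a v) (finite_support_smul 𝕂 M a w)
      map_smul' := fun r v => by
        have h : ∀ x : U 𝕂, x • r • v = r • x • v := fun x => by
          rw [← algebraMap_smul (U 𝕂) r v, smul_smul, ← Algebra.commutes, mul_smul,
            algebraMap_smul]
        simp only [h, RingHom.id_apply]
        exact (smul_finsum' r (finite_support_smul 𝕂 M a v)).symm }
  property := by
    intro M N f v
    have := AddMonoidHom.map_finsum f.toAddMonoidHom (finite_support_smul 𝕂 M a v)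
    simpa using this

/-! ### The quantum symmetric pair coideal subalgebra and the quasi K-matrix -/

/-- The diagram automorphism `τ`, which swaps the two nodes. -/
def tau : Equiv.Perm (Fin 2) := Equiv.swap 0 1

/-- The involution `Θ = -w_X τ = -τ` of the root lattice. -/
def Theta (l : Fin 2 → ℤ) : Fin 2 → ℤ := fun i => -l (tau i)

/-- The parameters `𝐜 = (c₁, c₂)` allowed for the bar involution: both are non-zero,
`cᵢ = c_{τ(i)}` because `(αᵢ, Θ(αᵢ)) = 0`, and `c_{τ(i)} = q^{(αᵢ, Θ(αᵢ))} \bar{cᵢ}`. -/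
structure IsParameter (𝕂 : Type u) [Field 𝕂] (c : Fin 2 → RatFunc 𝕂) : Prop where
  ne_zero : ∀ i, c i ≠ 0
  tau_eq : ∀ i, c i = c (tau i)
  bar_eq : ∀ i, c (tau i) = barQ 𝕂 (c i)

/-- The subalgebra `U⁰_Θ` generated by the `K_λ` with `Θ(λ) = λ`. -/
def UzeroTheta (𝕂 : Type u) [Field 𝕂] : Subalgebra (RatFunc 𝕂) (U 𝕂) :=
  Algebra.adjoin (RatFunc 𝕂) {x | ∃ l : Fin 2 → ℤ, Theta l = l ∧ x = (Kroot 𝕂 l : U 𝕂)}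

/-- The generator `Bᵢ = Fᵢ - cᵢ s(τ(i)) T_{w_X}(E_{τ(i)}) Kᵢ⁻¹ + sᵢ Kᵢ⁻¹`, where `X = ∅`,
`s(1) = s(2) = 1` and `𝐬 = (0, 0)`. -/
def B (𝕂 : Type u) [Field 𝕂] (c : Fin 2 → RatFunc 𝕂) (i : Fin 2) : U 𝕂 :=
  F 𝕂 i - c i • (E 𝕂 (tau i) * ((K 𝕂 i)⁻¹ : (U 𝕂)ˣ))

/-- The quantum symmetric pair coideal subalgebra `B_𝐜`, generated by `U⁰_Θ` and `B₁, B₂`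
(the generators coming from `X` are absent, as `X = ∅`). -/
def Bc (𝕂 : Type u) [Field 𝕂] (c : Fin 2 → RatFunc 𝕂) : Subalgebra (RatFunc 𝕂) (U 𝕂) :=
  Algebra.adjoin (RatFunc 𝕂) ((UzeroTheta 𝕂 : Set (U 𝕂)) ∪ Set.range (B 𝕂 c))

/-- `φ` is the bar involution of `B_𝐜`: it agrees with the bar involution of `U` on `U⁰_Θ`
and fixes `B₁, B₂`. -/
def IsBarInvolution (𝕂 : Type u) [Field 𝕂] (c : Fin 2 → RatFunc 𝕂)
    (φ : Bc 𝕂 c ≃ₐ[𝕂] Bc 𝕂 c) : Prop :=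
  (∀ b : Bc 𝕂 c, (b : U 𝕂) ∈ UzeroTheta 𝕂 → (φ b : U 𝕂) = barU 𝕂 b) ∧
  ∀ (i : Fin 2) (b : Bc 𝕂 c), (b : U 𝕂) = B 𝕂 c i → φ b = b

/-- `𝔛 = ∑_μ 𝔛_μ ∈ Û⁺` is a quasi K-matrix for `B_𝐜` with bar involution `φ`: `𝔛₀ = 1` and
`φ(b) 𝔛 = 𝔛 \bar{b}` holds in `𝒰` for all `b ∈ B_𝐜`. -/
def IsQuasiKMatrix (𝕂 : Type u) [Field 𝕂] (c : Fin 2 → RatFunc 𝕂)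
    (φ : Bc 𝕂 c ≃ₐ[𝕂] Bc 𝕂 c) (𝔛 : Uhat 𝕂) : Prop :=
  (𝔛 0 : U 𝕂) = 1 ∧
  ∀ b : Bc 𝕂 c, ofU 𝕂 (φ b : U 𝕂) * ofUhat 𝕂 𝔛 = ofUhat 𝕂 𝔛 * ofU 𝕂 (barU 𝕂 b)

/-! ### The explicit formula -/

/-- `{n} = 1 + q² + ⋯ + q^{2(n-1)}` -/
def qbrace (𝕂 : Type u) [Field 𝕂] (n : ℕ) : RatFunc 𝕂 := ∑ k ∈ Finset.range n, q 𝕂 ^ (2 * k)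

/-- `{n}! = {1}{2}⋯{n}` -/
def qbraceFactorial (𝕂 : Type u) [Field 𝕂] (n : ℕ) : RatFunc 𝕂 :=
  ∏ k ∈ Finset.range n, qbrace 𝕂 (k + 1)

end AIII11

end

/-!
By the relation `[B₁, B₂] = c₁ (q - q⁻¹)⁻¹ (L - L⁻¹)` with `L = K₁ K₂⁻¹`, the assignment
`E₁ ↦ -c₁⁻¹ B₂`, `F₁ ↦ B₁`, `K₁ ↦ L` and `E₂, F₂ ↦ 0`, `K₂ ↦ 1` defines a homomorphism `U → B_𝐜`.
It sends the bar conjugates of `B₁`, `B₂` and `L` to `B₁`, `B₂` and `L⁻¹`, so that its composition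
with the bar involution of `U` restricts to the bar involution of `B_𝐜`.

For `Bᵢ` the intertwining property is a formula for the commutator `[𝔛, Fᵢ]`. For the explicit `𝔛`
this follows from the formula for `[Eᵢⁿ⁺¹, Fᵢ]`, because the coefficients `aₙ` of `𝔛` satisfy
`{n+1} (q - q⁻¹)⁻¹ aₙ₊₁ = c₁ aₙ`.

For the uniqueness, apply `𝔛` to the lowest weight vector `v` of `V(N) ⊗ V(N)`. Since `Fᵢ v = 0`,
the intertwining property becomes a recurrence for the coordinates of `𝔛 v`, and these are therefore
determined by the one at the lowest weight, which is `1`. If `N` is large, the elements of `U⁺_μ`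
are in turn determined by their action on `v`.
-/

noncomputable section

namespace AIII11

open Polynomial

variable {𝕂 : Type u} [Field 𝕂]

/-! ### Scalars -/

lemma barQ_barQ (r : RatFunc 𝕂) : barQ 𝕂 (barQ 𝕂 r) = r := by
  have h : (barQ 𝕂).comp (barQ 𝕂) = AlgHom.id 𝕂 (RatFunc 𝕂) :=
    IsLocalization.algHom_ext (nonZeroDivisors 𝕂[X]) <| Polynomial.algHom_ext <| by
      change barQ 𝕂 (barQ 𝕂 (algebraMap 𝕂[X] (RatFunc 𝕂) X)) = algebraMap 𝕂[X] (RatFunc 𝕂) X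
      rw [RatFunc.algebraMap_X, barQ_q, map_inv₀, barQ_q, inv_inv]
  exact DFunLike.congr_fun h r

lemma q_sub_q_inv_ne_zero : q 𝕂 - (q 𝕂)⁻¹ ≠ 0 := by
  intro h
  apply q_pow_ne_one 𝕂 two_ne_zero
  rw [pow_two, mul_eq_one_iff_eq_inv₀ (q_ne_zero 𝕂)]
  exact sub_eq_zero.1 h

lemma tau_zero : tau 0 = 1 := Equiv.swap_apply_left 0 1

lemma tau_one : tau 1 = 0 := Equiv.swap_apply_right 0 1

lemma tau_ne (i : Fin 2) : tau i ≠ i := by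
  fin_cases i <;> simp [tau]

lemma IsParameter.apply_eq_apply_zero {c : Fin 2 → RatFunc 𝕂} (hc : IsParameter 𝕂 c) (i : Fin 2) :
    c i = c 0 := by
  fin_cases i
  · rfl
  · exact tau_one ▸ hc.tau_eq 1

lemma cartan_self (i : Fin 2) : cartan i i = 2 := if_pos rfl

lemma cartan_of_ne {i j : Fin 2} (h : i ≠ j) : cartan i j = 0 := if_neg h

/-! ### Weights -/

section HasWeight

variable {A : Type*} [Ring A] [Algebra (RatFunc 𝕂) A] {k k' : Aˣ} {m n : ℤ} {x y : A}

variable (𝕂) in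
/-- `x` is an eigenvector with eigenvalue `qⁿ` of the conjugation `k x k⁻¹`. -/
def HasWeight (k : Aˣ) (n : ℤ) (x : A) : Prop := SemiconjBy (k : A) x (q 𝕂 ^ n • x)

lemma hasWeight_iff_conj : HasWeight 𝕂 k n x ↔ (k : A) * x * ↑k⁻¹ = q 𝕂 ^ n • x :=
  (Units.mul_inv_eq_iff_eq_mul k).symm

lemma hasWeight_zero_iff : HasWeight 𝕂 k 0 x ↔ Commute (k : A) x := by
  rw [HasWeight, zpow_zero, one_smul, Commute]

namespace HasWeight

lemma eq (h : HasWeight 𝕂 k n x) : (k : A) * x = q 𝕂 ^ n • (x * k) :=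
  (SemiconjBy.eq h).trans (smul_mul_assoc _ _ _)

lemma mul (hx : HasWeight 𝕂 k m x) (hy : HasWeight 𝕂 k n y) : HasWeight 𝕂 k (m + n) (x * y) := by
  rw [HasWeight, zpow_add₀ (q_ne_zero 𝕂), ← smul_mul_smul_comm]
  exact SemiconjBy.mul_right hx hy

lemma pow (hx : HasWeight 𝕂 k n x) (a : ℕ) : HasWeight 𝕂 k (n * a) (x ^ a) := by
  rw [HasWeight, zpow_mul, zpow_natCast, ← _root_.smul_pow]
  exact SemiconjBy.pow_right hx a

lemma smul (hx : HasWeight 𝕂 k n x) (r : RatFunc 𝕂) : HasWeight 𝕂 k n (r • x) := by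
  rw [HasWeight, SemiconjBy, mul_smul_comm, hx.eq, smul_mul_assoc, smul_mul_assoc, smul_comm]

lemma sub (hx : HasWeight 𝕂 k n x) (hy : HasWeight 𝕂 k n y) : HasWeight 𝕂 k n (x - y) := by
  rw [HasWeight, smul_sub]
  exact SemiconjBy.sub_right hx hy

lemma inv_left (hx : HasWeight 𝕂 k n x) : HasWeight 𝕂 k⁻¹ (-n) x := by
  have h : SemiconjBy (↑k⁻¹ : A) (q 𝕂 ^ n • x) x := SemiconjBy.units_inv_symm_left hx
  rw [HasWeight, SemiconjBy, smul_mul_assoc, ← h.eq, mul_smul_comm, smul_smul,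
    ← zpow_add₀ (q_ne_zero 𝕂), neg_add_cancel, zpow_zero, one_smul]

lemma mul_left (hx : HasWeight 𝕂 k m x) (hx' : HasWeight 𝕂 k' n x) :
    HasWeight 𝕂 (k * k') (m + n) x := by
  rw [HasWeight, Units.val_mul, zpow_add₀ (q_ne_zero 𝕂), mul_comm, mul_smul]
  have h := hx.smul (q 𝕂 ^ n)
  rw [HasWeight, smul_comm] at h
  exact SemiconjBy.mul_left h hx'

end HasWeight

end HasWeight

/-! ### Relations and the universal property of `U` -/

lemma K_commute (i j : Fin 2) : Commute (K 𝕂 i) (K 𝕂 j) := by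
  have h := proj_rel 𝕂 (Rel.K_comm i j)
  simp only [map_mul] at h
  exact Units.ext h

lemma hasWeight_E (i j : Fin 2) : HasWeight 𝕂 (K 𝕂 i) (cartan i j) (E 𝕂 j) := by
  have h := proj_rel 𝕂 (Rel.K_E i j)
  simp only [map_mul, map_smul] at h
  exact hasWeight_iff_conj.2 h

lemma hasWeight_F (i j : Fin 2) : HasWeight 𝕂 (K 𝕂 i) (-cartan i j) (F 𝕂 j) := by
  have h := proj_rel 𝕂 (Rel.K_F i j)
  simp only [map_mul, map_smul] at h
  exact hasWeight_iff_conj.2 h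

lemma K_commute_E {i j : Fin 2} (h : i ≠ j) : Commute (K 𝕂 i : U 𝕂) (E 𝕂 j) :=
  hasWeight_zero_iff.1 (cartan_of_ne h ▸ hasWeight_E i j)

lemma K_commute_F {i j : Fin 2} (h : i ≠ j) : Commute (K 𝕂 i : U 𝕂) (F 𝕂 j) := by
  have hF := hasWeight_F (𝕂 := 𝕂) i j
  rwa [cartan_of_ne h, neg_zero, hasWeight_zero_iff] at hF

lemma E_mul_F_sub (i : Fin 2) : E 𝕂 i * F 𝕂 i - F 𝕂 i * E 𝕂 i =
    (q 𝕂 - (q 𝕂)⁻¹)⁻¹ • ((K 𝕂 i : U 𝕂) - ↑(K 𝕂 i)⁻¹) := by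
  have h := proj_rel 𝕂 (Rel.E_F_same i)
  simp only [map_mul, map_sub, map_smul] at h
  exact h

lemma E_commute_F {i j : Fin 2} (h : i ≠ j) : Commute (E 𝕂 i) (F 𝕂 j) := by
  have h := proj_rel 𝕂 (Rel.E_F_ne i j h)
  simp only [map_mul, map_sub, map_zero, sub_eq_zero] at h
  exact h

lemma E_commute (i j : Fin 2) : Commute (E 𝕂 i) (E 𝕂 j) := by
  obtain rfl | h := eq_or_ne i j
  · exact Commute.refl _
  · have h := proj_rel 𝕂 (Rel.serre_E i j h)
    simp only [map_mul, map_sub, map_zero, sub_eq_zero] at h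
    exact h

lemma F_commute (i j : Fin 2) : Commute (F 𝕂 i) (F 𝕂 j) := by
  obtain rfl | h := eq_or_ne i j
  · exact Commute.refl _
  · have h := proj_rel 𝕂 (Rel.serre_F i j h)
    simp only [map_mul, map_sub, map_zero, sub_eq_zero] at h
    exact h

/-- Elements of an algebra that satisfy the defining relations of `U`; they are the same thing as an
algebra homomorphism out of `U`. -/
structure ChevalleyGenerators (𝕂 : Type u) [Field 𝕂] (A : Type*) [Ring A]
    [Algebra (RatFunc 𝕂) A] where
  E : Fin 2 → A
  F : Fin 2 → A
  K : Fin 2 → Aˣ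
  K_commute : Commute (K 0) (K 1)
  hasWeight_E (i j : Fin 2) : HasWeight 𝕂 (K i) (cartan i j) (E j)
  hasWeight_F (i j : Fin 2) : HasWeight 𝕂 (K i) (-cartan i j) (F j)
  E_mul_F_sub (i : Fin 2) :
    E i * F i - F i * E i = (q 𝕂 - (q 𝕂)⁻¹)⁻¹ • ((K i : A) - ↑(K i)⁻¹)
  E_commute_F (i j : Fin 2) (h : i ≠ j) : Commute (E i) (F j)
  E_commute : Commute (E 0) (E 1)
  F_commute : Commute (F 0) (F 1)

lemma commute_of_commute_zero_one {M : Type*} [Mul M] {x : Fin 2 → M} (h : Commute (x 0) (x 1))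
    (i j : Fin 2) : Commute (x i) (x j) := by
  fin_cases i <;> fin_cases j
  exacts [Commute.refl _, h, h.symm, Commute.refl _]

namespace ChevalleyGenerators

variable {A : Type*} [Ring A] [Algebra (RatFunc 𝕂) A] (X : ChevalleyGenerators 𝕂 A)

/-- The image of a generator of the free algebra under the homomorphism defined by `X`. -/
def ofGen : Gen → A
  | .E i => X.E i
  | .F i => X.F i
  | .K i => X.K i
  | .Kinv i => ↑(X.K i)⁻¹

lemma lift_ofGen_rel ⦃x y : Free 𝕂⦄ (h : Rel 𝕂 x y) :
    FreeAlgebra.lift (RatFunc 𝕂) X.ofGen x = FreeAlgebra.lift (RatFunc 𝕂) X.ofGen y := by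
  cases h <;> simp only [map_mul, map_sub, map_smul, map_one, map_zero, FreeAlgebra.lift_ι_apply,
    ofGen, sub_eq_zero]
  case K_mul_Kinv i => exact (X.K i).mul_inv
  case Kinv_mul_K i => exact (X.K i).inv_mul
  case K_comm i j => exact congrArg Units.val (commute_of_commute_zero_one X.K_commute i j).eq
  case K_E i j => exact hasWeight_iff_conj.1 (X.hasWeight_E i j)
  case K_F i j => exact hasWeight_iff_conj.1 (X.hasWeight_F i j)
  case E_F_same i => exact X.E_mul_F_sub i
  case E_F_ne i j h => exact X.E_commute_F i j h
  case serre_E i j h => exact commute_of_commute_zero_one X.E_commute i j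
  case serre_F i j h => exact commute_of_commute_zero_one X.F_commute i j

/-- The algebra homomorphism `U → A` defined by `X`. -/
def hom : U 𝕂 →ₐ[RatFunc 𝕂] A :=
  liftU 𝕂 (FreeAlgebra.lift (RatFunc 𝕂) X.ofGen) X.lift_ofGen_rel

lemma hom_ofGen (g : Gen) : X.hom (AIII11.ofGen 𝕂 g) = X.ofGen g :=
  (liftU_proj 𝕂 _ X.lift_ofGen_rel (gen 𝕂 g)).trans (FreeAlgebra.lift_ι_apply _ _)

lemma hom_E (i : Fin 2) : X.hom (AIII11.E 𝕂 i) = X.E i := X.hom_ofGen _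

lemma hom_F (i : Fin 2) : X.hom (AIII11.F 𝕂 i) = X.F i := X.hom_ofGen _

lemma hom_K (i : Fin 2) : X.hom (AIII11.K 𝕂 i : U 𝕂) = X.K i := X.hom_ofGen _

lemma map_hom_K (i : Fin 2) : Units.map (X.hom : U 𝕂 →* A) (AIII11.K 𝕂 i) = X.K i :=
  Units.ext (X.hom_K i)

end ChevalleyGenerators

/-! ### The subalgebra `B_𝐜` -/

/-- `K₁ K₂⁻¹`, which together with its inverse generates `U⁰_Θ`. -/
def L (𝕂 : Type u) [Field 𝕂] : (U 𝕂)ˣ := K 𝕂 0 * (K 𝕂 1)⁻¹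

lemma L_inv : (L 𝕂)⁻¹ = K 𝕂 1 * (K 𝕂 0)⁻¹ := by
  rw [L, mul_inv_rev, inv_inv]

lemma hasWeight_L {x : U 𝕂} {m n : ℤ} (h0 : HasWeight 𝕂 (K 𝕂 0) m x)
    (h1 : HasWeight 𝕂 (K 𝕂 1) n x) : HasWeight 𝕂 (L 𝕂) (m - n) x :=
  sub_eq_add_neg m n ▸ h0.mul_left h1.inv_left

lemma Theta_eq_self_iff (l : Fin 2 → ℤ) : Theta l = l ↔ l 1 = -l 0 := by
  rw [funext_iff, Fin.forall_fin_two, Theta, Theta, tau_zero, tau_one]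
  omega

lemma Kroot_eq_L_zpow {l : Fin 2 → ℤ} (h : Theta l = l) : Kroot 𝕂 l = L 𝕂 ^ l 0 := by
  rw [Kroot, L, (Theta_eq_self_iff l).1 h, (K_commute 0 1).inv_right.mul_zpow, inv_zpow, zpow_neg]

lemma L_zpow_mem_UzeroTheta (n : ℤ) : (↑(L 𝕂 ^ n) : U 𝕂) ∈ UzeroTheta 𝕂 := by
  have h : Theta ![n, -n] = ![n, -n] := (Theta_eq_self_iff _).2 rfl
  exact Algebra.subset_adjoin ⟨_, h, congrArg Units.val (Kroot_eq_L_zpow h).symm⟩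

lemma mem_of_mem_adjoin {R A : Type*} [CommSemiring R] [Ring A] [Algebra R A] {s : Set A}
    {S : Subring A} (hR : ∀ r, algebraMap R A r ∈ S) (hs : s ⊆ S) {x : A}
    (hx : x ∈ Algebra.adjoin R s) : x ∈ S :=
  Algebra.adjoin_le (S := { S.toSubsemiring with algebraMap_mem' := hR }) hs hx

lemma mem_of_mem_UzeroTheta {S : Subring (U 𝕂)} (hS : ∀ r, algebraMap (RatFunc 𝕂) (U 𝕂) r ∈ S)
    (hL : (L 𝕂 : U 𝕂) ∈ S) (hL' : (↑(L 𝕂)⁻¹ : U 𝕂) ∈ S) {x : U 𝕂} (hx : x ∈ UzeroTheta 𝕂) :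
    x ∈ S := by
  refine mem_of_mem_adjoin hS ?_ hx
  rintro _ ⟨l, hl, rfl⟩
  rw [Kroot_eq_L_zpow hl]
  obtain ⟨n, h | h⟩ := (l 0).eq_nat_or_neg
  · rw [h, zpow_natCast, Units.val_pow_eq_pow_val]
    exact pow_mem hL n
  · rw [h, ← inv_zpow', zpow_natCast, Units.val_pow_eq_pow_val]
    exact pow_mem hL' n

lemma UzeroTheta_le_Bc (c : Fin 2 → RatFunc 𝕂) : UzeroTheta 𝕂 ≤ Bc 𝕂 c :=
  fun _ hx => Algebra.subset_adjoin (Or.inl hx)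

lemma B_mem_Bc (c : Fin 2 → RatFunc 𝕂) (i : Fin 2) : B 𝕂 c i ∈ Bc 𝕂 c :=
  Algebra.subset_adjoin (Or.inr ⟨i, rfl⟩)

lemma mem_of_mem_Bc {c : Fin 2 → RatFunc 𝕂} {S : Subring (U 𝕂)}
    (hS : ∀ r, algebraMap (RatFunc 𝕂) (U 𝕂) r ∈ S) (hL : (L 𝕂 : U 𝕂) ∈ S)
    (hL' : (↑(L 𝕂)⁻¹ : U 𝕂) ∈ S) (hB : ∀ i, B 𝕂 c i ∈ S) {x : U 𝕂} (hx : x ∈ Bc 𝕂 c) : x ∈ S := by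
  refine mem_of_mem_adjoin hS ?_ hx
  rintro y (hy | ⟨i, rfl⟩)
  exacts [mem_of_mem_UzeroTheta hS hL hL' hy, hB i]

lemma hasWeight_L_B (c : Fin 2 → RatFunc 𝕂) (i : Fin 2) :
    HasWeight 𝕂 (L 𝕂) (cartan 1 i - cartan 0 i) (B 𝕂 c i) := by
  have hF : HasWeight 𝕂 (L 𝕂) (cartan 1 i - cartan 0 i) (F 𝕂 i) := by
    convert hasWeight_L (hasWeight_F 0 i) (hasWeight_F 1 i) using 1
    ring
  have hK : HasWeight 𝕂 (L 𝕂) 0 (↑(K 𝕂 i)⁻¹ : U 𝕂) := by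
    have h := ((K_commute (𝕂 := 𝕂) 0 i).mul_left (K_commute 1 i).inv_left).inv_right
    exact hasWeight_zero_iff.2 (congrArg Units.val h.eq)
  have hE : HasWeight 𝕂 (L 𝕂) (cartan 1 i - cartan 0 i) (E 𝕂 (tau i) * ↑(K 𝕂 i)⁻¹) := by
    convert (hasWeight_L (hasWeight_E 0 (tau i)) (hasWeight_E 1 (tau i))).mul hK using 1
    fin_cases i <;> simp [cartan, tau]
  exact hF.sub (hE.smul (c i))

lemma E_mul_Kinv_commute :
    Commute (E 𝕂 1 * ↑(K 𝕂 0)⁻¹) (E 𝕂 0 * (↑(K 𝕂 1)⁻¹ : U 𝕂)) := by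
  have key (i j : Fin 2) : E 𝕂 j * ↑(K 𝕂 i)⁻¹ * (E 𝕂 i * ↑(K 𝕂 j)⁻¹) =
      q 𝕂 ^ (-2 : ℤ) • (E 𝕂 j * E 𝕂 i * (↑((K 𝕂 i)⁻¹ * (K 𝕂 j)⁻¹) : U 𝕂)) := by
    rw [mul_assoc, ← mul_assoc _ (E 𝕂 i), (hasWeight_E i i).inv_left.eq, cartan_self]
    simp only [smul_mul_assoc, mul_smul_comm, mul_assoc, Units.val_mul]
  rw [commute_iff_eq, key, key, (E_commute 1 0).eq, (K_commute (𝕂 := 𝕂) 0 1).inv_inv.eq]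

lemma F_mul_E_mul_Kinv_sub {i j : Fin 2} (h : i ≠ j) :
    F 𝕂 i * (E 𝕂 i * ↑(K 𝕂 j)⁻¹) - E 𝕂 i * ↑(K 𝕂 j)⁻¹ * F 𝕂 i =
      (q 𝕂 - (q 𝕂)⁻¹)⁻¹ • ((↑(K 𝕂 i)⁻¹ - K 𝕂 i : U 𝕂) * ↑(K 𝕂 j)⁻¹) := by
  rw [mul_assoc, (K_commute_F h.symm).units_inv_left.eq, ← mul_assoc, ← mul_assoc, ← sub_mul,
    ← neg_sub (E 𝕂 i * F 𝕂 i), E_mul_F_sub, ← smul_neg, neg_sub, smul_mul_assoc]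

lemma B_mul_B_sub {c : Fin 2 → RatFunc 𝕂} (hc : c 1 = c 0) :
    B 𝕂 c 0 * B 𝕂 c 1 - B 𝕂 c 1 * B 𝕂 c 0 =
      (c 0 * (q 𝕂 - (q 𝕂)⁻¹)⁻¹) • ((L 𝕂 : U 𝕂) - ↑(L 𝕂)⁻¹) := by
  have hZ := (E_mul_Kinv_commute (𝕂 := 𝕂)).eq
  have h0 := F_mul_E_mul_Kinv_sub (𝕂 := 𝕂) zero_ne_one
  have h1 := F_mul_E_mul_Kinv_sub (𝕂 := 𝕂) one_ne_zero
  have hKK : (↑(K 𝕂 0)⁻¹ : U 𝕂) * ↑(K 𝕂 1)⁻¹ = ↑(K 𝕂 1)⁻¹ * ↑(K 𝕂 0)⁻¹ :=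
    congrArg Units.val (K_commute (𝕂 := 𝕂) 0 1).inv_inv.eq
  simp only [B, tau_zero, tau_one, hc]
  generalize E 𝕂 1 * (↑(K 𝕂 0)⁻¹ : U 𝕂) = Z₀ at *
  generalize E 𝕂 0 * (↑(K 𝕂 1)⁻¹ : U 𝕂) = Z₁ at *
  calc (F 𝕂 0 - c 0 • Z₀) * (F 𝕂 1 - c 0 • Z₁) - (F 𝕂 1 - c 0 • Z₁) * (F 𝕂 0 - c 0 • Z₀)
      = c 0 • ((F 𝕂 1 * Z₀ - Z₀ * F 𝕂 1) - (F 𝕂 0 * Z₁ - Z₁ * F 𝕂 0)) := by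
        simp only [mul_sub, sub_mul, mul_smul_comm, smul_mul_assoc, hZ, (F_commute 0 1).eq,
          smul_sub]
        abel
    _ = (c 0 * (q 𝕂 - (q 𝕂)⁻¹)⁻¹) • ((L 𝕂 : U 𝕂) - ↑(L 𝕂)⁻¹) := by
        rw [h0, h1, ← smul_sub, smul_smul, L_inv, L, Units.val_mul, Units.val_mul, sub_mul, sub_mul,
          hKK]
        abel_nf

/-! ### The bar involution of `B_𝐜` -/

section BarInvolution

variable {c : Fin 2 → RatFunc 𝕂} (hc : IsParameter 𝕂 c)

/-- The generators `-c₁⁻¹ B₂, B₁, L` of a copy of `U_q(sl₂)` in `B_𝐜`, extended by `0, 0, 1` at the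
second node. -/
def retractionGenerators : ChevalleyGenerators 𝕂 (U 𝕂) where
  E := ![-(c 0)⁻¹ • B 𝕂 c 1, 0]
  F := ![B 𝕂 c 0, 0]
  K := ![L 𝕂, 1]
  K_commute := Commute.one_right _
  hasWeight_E i j := by
    have hB := (hasWeight_L_B c 1).smul (-(c 0)⁻¹)
    fin_cases i <;> fin_cases j <;> simp_all [cartan, hasWeight_iff_conj]
  hasWeight_F i j := by
    have hB := hasWeight_L_B c 0
    fin_cases i <;> fin_cases j <;> simp_all [cartan, hasWeight_iff_conj]
  E_mul_F_sub := by
    refine Fin.forall_fin_two.2 ⟨?_, by simp⟩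
    have h := congrArg ((c 0)⁻¹ • ·) (B_mul_B_sub (hc.apply_eq_apply_zero 1))
    simp only [smul_smul, inv_mul_cancel_left₀ (hc.ne_zero 0)] at h
    simpa only [Matrix.cons_val_zero, neg_smul, neg_mul, mul_neg, neg_sub_neg, smul_mul_assoc,
      mul_smul_comm, smul_sub] using h
  E_commute_F i j h := by
    fin_cases i <;> fin_cases j <;> simp_all
  E_commute := Commute.zero_right _
  F_commute := Commute.zero_right _

/-- The algebra endomorphism of `U` that is a retraction onto `B_𝐜`. -/
def retraction : U 𝕂 →ₐ[RatFunc 𝕂] U 𝕂 := (retractionGenerators hc).hom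

lemma map_retraction_L : Units.map (retraction hc : U 𝕂 →* U 𝕂) (L 𝕂) = L 𝕂 := by
  have h (i : Fin 2) : Units.map (retraction hc : U 𝕂 →* U 𝕂) (K 𝕂 i) = ![L 𝕂, 1] i :=
    (retractionGenerators hc).map_hom_K i
  conv_lhs => rw [L, map_mul, map_inv, h, h]
  exact (congrArg (L 𝕂 * ·) inv_one).trans (mul_one _)

lemma map_barU_K (i : Fin 2) : Units.map (barU 𝕂 : U 𝕂 →* U 𝕂) (K 𝕂 i) = (K 𝕂 i)⁻¹ :=
  Units.ext (barU_ofGen 𝕂 (.K i))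

lemma map_barU_L : Units.map (barU 𝕂 : U 𝕂 →* U 𝕂) (L 𝕂) = (L 𝕂)⁻¹ := by
  rw [L, map_mul, map_inv, map_barU_K, map_barU_K, mul_inv_rev]
  exact (K_commute (𝕂 := 𝕂) 0 1).inv_inv.inv_right.eq

include hc in
lemma barU_B (i : Fin 2) :
    barU 𝕂 (B 𝕂 c i) = F 𝕂 i - c i • (E 𝕂 (tau i) * (K 𝕂 i : U 𝕂)) := by
  have hci : barQ 𝕂 (c i) = c i := by rw [← hc.bar_eq, ← hc.tau_eq]
  have hK : barU 𝕂 (↑(K 𝕂 i)⁻¹ : U 𝕂) = K 𝕂 i := barU_ofGen 𝕂 (.Kinv i)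
  simp only [B, map_sub, Algebra.smul_def, map_mul, barU_algebraMap, hci, hK, barU_ofGen, barGen]

lemma retraction_barU_B (i : Fin 2) : retraction hc (barU 𝕂 (B 𝕂 c i)) = B 𝕂 c i := by
  have hc1 := hc.apply_eq_apply_zero 1
  have hE : retraction hc (E 𝕂 (tau i)) = ![-(c 0)⁻¹ • B 𝕂 c 1, 0] (tau i) :=
    (retractionGenerators hc).hom_E _
  have hF : retraction hc (F 𝕂 i) = ![B 𝕂 c 0, 0] i := (retractionGenerators hc).hom_F i
  have hK : retraction hc (K 𝕂 i : U 𝕂) = ![L 𝕂, 1] i := (retractionGenerators hc).hom_K i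
  rw [barU_B hc, map_sub, map_smul, map_mul, hE, hF, hK]
  fin_cases i <;> simp [tau, hc1, smul_smul, hc.ne_zero 0]

/-- The ring endomorphism of `U` that restricts to the bar involution of `B_𝐜`. -/
def barRetraction : U 𝕂 →+* U 𝕂 := (retraction hc : U 𝕂 →+* U 𝕂).comp (barU 𝕂)

lemma barRetraction_algebraMap (r : RatFunc 𝕂) :
    barRetraction hc (algebraMap (RatFunc 𝕂) (U 𝕂) r) =
      algebraMap (RatFunc 𝕂) (U 𝕂) (barQ 𝕂 r) :=
  (congrArg (retraction hc) (barU_algebraMap 𝕂 r)).trans ((retraction hc).commutes _)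

lemma map_barRetraction_L :
    Units.map (barRetraction hc : U 𝕂 →* U 𝕂) (L 𝕂) = (L 𝕂)⁻¹ := by
  change Units.map (retraction hc : U 𝕂 →* U 𝕂) (Units.map (barU 𝕂 : U 𝕂 →* U 𝕂) (L 𝕂)) = _
  rw [map_barU_L, map_inv, map_retraction_L]

lemma barRetraction_L : barRetraction hc (L 𝕂 : U 𝕂) = ↑(L 𝕂)⁻¹ :=
  congrArg Units.val (map_barRetraction_L hc)

lemma barRetraction_L_inv : barRetraction hc (↑(L 𝕂)⁻¹ : U 𝕂) = L 𝕂 := by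
  have h := map_inv (Units.map (barRetraction hc : U 𝕂 →* U 𝕂)) (L 𝕂)
  rw [map_barRetraction_L, inv_inv] at h
  exact congrArg Units.val h

lemma barRetraction_B (i : Fin 2) : barRetraction hc (B 𝕂 c i) = B 𝕂 c i :=
  retraction_barU_B hc i

lemma barU_L : barU 𝕂 (L 𝕂 : U 𝕂) = ↑(L 𝕂)⁻¹ :=
  congrArg Units.val map_barU_L

lemma barU_L_inv : barU 𝕂 (↑(L 𝕂)⁻¹ : U 𝕂) = L 𝕂 := by
  have h := map_inv (Units.map (barU 𝕂 : U 𝕂 →* U 𝕂)) (L 𝕂)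
  rw [map_barU_L, inv_inv] at h
  exact congrArg Units.val h

lemma barRetraction_mem_Bc {x : U 𝕂} (hx : x ∈ Bc 𝕂 c) : barRetraction hc x ∈ Bc 𝕂 c := by
  have hL (n : ℤ) : (↑(L 𝕂 ^ n) : U 𝕂) ∈ Bc 𝕂 c := UzeroTheta_le_Bc c (L_zpow_mem_UzeroTheta n)
  rw [← Subalgebra.mem_toSubring, ← Subring.mem_comap]
  refine mem_of_mem_Bc (fun r => ?_) ?_ ?_ (fun i => ?_) hx <;>
    rw [Subring.mem_comap, Subalgebra.mem_toSubring]
  · exact barRetraction_algebraMap hc r ▸ algebraMap_mem _ _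
  · simpa only [barRetraction_L, zpow_neg_one] using hL (-1)
  · simpa only [barRetraction_L_inv, zpow_one] using hL 1
  · exact (barRetraction_B hc i).symm ▸ B_mem_Bc c i

lemma barRetraction_barRetraction {x : U 𝕂} (hx : x ∈ Bc 𝕂 c) :
    barRetraction hc (barRetraction hc x) = x := by
  have key : x ∈ ((barRetraction hc).comp (barRetraction hc)).eqLocus (RingHom.id (U 𝕂)) := by
    refine mem_of_mem_Bc (fun r => ?_) ?_ ?_ (fun i => ?_) hx <;>
      simp only [RingHom.mem_eqLocus, RingHom.comp_apply, RingHom.id_apply,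
        barRetraction_algebraMap, barQ_barQ, barRetraction_L, barRetraction_L_inv, barRetraction_B]
  exact key

lemma barRetraction_eq_barU {x : U 𝕂} (hx : x ∈ UzeroTheta 𝕂) :
    barRetraction hc x = barU 𝕂 x := by
  have key : x ∈ (barRetraction hc).eqLocus (barU 𝕂) := by
    refine mem_of_mem_UzeroTheta (fun r => ?_) ?_ ?_ hx <;>
      simp only [RingHom.mem_eqLocus, barRetraction_algebraMap, barU_algebraMap, barRetraction_L,
        barU_L, barRetraction_L_inv, barU_L_inv]
  exact key

/-- The bar involution of `B_𝐜`. -/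
def barB : Bc 𝕂 c ≃ₐ[𝕂] Bc 𝕂 c where
  toFun b := ⟨barRetraction hc b, barRetraction_mem_Bc hc b.2⟩
  invFun b := ⟨barRetraction hc b, barRetraction_mem_Bc hc b.2⟩
  left_inv b := Subtype.ext (barRetraction_barRetraction hc b.2)
  right_inv b := Subtype.ext (barRetraction_barRetraction hc b.2)
  map_mul' _ _ := Subtype.ext (map_mul _ _ _)
  map_add' _ _ := Subtype.ext (map_add _ _ _)
  commutes' r := Subtype.ext <|
    (barRetraction_algebraMap hc (algebraMap 𝕂 (RatFunc 𝕂) r)).trans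
      (congrArg (algebraMap (RatFunc 𝕂) (U 𝕂)) ((barQ 𝕂).commutes r))

lemma coe_barB (b : Bc 𝕂 c) : (barB hc b : U 𝕂) = barRetraction hc b := rfl

theorem isBarInvolution_iff (ψ : Bc 𝕂 c ≃ₐ[𝕂] Bc 𝕂 c) :
    IsBarInvolution 𝕂 c ψ ↔ ψ = barB hc := by
  constructor
  · rintro ⟨hU, hB⟩
    let S : Subring (U 𝕂) :=
      ((ψ : Bc 𝕂 c →+* Bc 𝕂 c).eqLocus (barB hc : Bc 𝕂 c →+* Bc 𝕂 c)).map (Bc 𝕂 c).subtype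
    have hU' {x : U 𝕂} (hx : x ∈ UzeroTheta 𝕂) : x ∈ S :=
      ⟨⟨x, UzeroTheta_le_Bc c hx⟩,
        Subtype.ext ((hU _ hx).trans (barRetraction_eq_barU hc hx).symm), rfl⟩
    have hB' (i : Fin 2) : B 𝕂 c i ∈ S :=
      ⟨⟨B 𝕂 c i, B_mem_Bc c i⟩,
        (hB i _ rfl).trans (Subtype.ext (barRetraction_B hc i).symm), rfl⟩
    have hL (n : ℤ) : (↑(L 𝕂 ^ n) : U 𝕂) ∈ S := hU' (L_zpow_mem_UzeroTheta n)
    refine AlgEquiv.ext fun b => ?_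
    obtain ⟨b', hb', h⟩ := mem_of_mem_Bc (fun r => hU' (algebraMap_mem _ r))
      (by simpa only [zpow_one] using hL 1) (by simpa only [zpow_neg_one] using hL (-1)) hB' b.2
    exact Subtype.ext h ▸ hb'
  · rintro rfl
    exact ⟨fun b hb => barRetraction_eq_barU hc hb,
      fun i b hb => Subtype.ext (by rw [coe_barB, hb, barRetraction_B])⟩

end BarInvolution

/-! ### Intertwining with `B_𝐜` -/

/-- The elements `r` with `f r * x = x * g r`. -/
def intertwinerSubring {R S : Type*} [Ring R] [Ring S] (f g : R →+* S) (x : S) : Subring R where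
  carrier := {r | f r * x = x * g r}
  mul_mem' {a b} (ha : f a * x = x * g a) (hb : f b * x = x * g b) := by
    simp only [Set.mem_ofPred_eq, map_mul, mul_assoc, hb]
    rw [← mul_assoc, ha, mul_assoc]
  one_mem' := by simp only [Set.mem_ofPred_eq, map_one, one_mul, mul_one]
  add_mem' {a b} (ha : f a * x = x * g a) (hb : f b * x = x * g b) := by
    simp only [Set.mem_ofPred_eq, map_add, add_mul, mul_add, ha, hb]
  zero_mem' := by simp only [Set.mem_ofPred_eq, map_zero, zero_mul, mul_zero]
  neg_mem' {a} (ha : f a * x = x * g a) := by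
    simp only [Set.mem_ofPred_eq, map_neg, neg_mul, mul_neg, ha]

lemma isQuasiKMatrix_iff {c : Fin 2 → RatFunc 𝕂} (hc : IsParameter 𝕂 c) (𝔛 : Uhat 𝕂) :
    IsQuasiKMatrix 𝕂 c (barB hc) 𝔛 ↔ (𝔛 0 : U 𝕂) = 1 ∧
      Commute (ofU 𝕂 (L 𝕂 : U 𝕂)) (ofUhat 𝕂 𝔛) ∧
      ∀ i, ofU 𝕂 (B 𝕂 c i) * ofUhat 𝕂 𝔛 =
        ofUhat 𝕂 𝔛 * ofU 𝕂 (F 𝕂 i - c i • (E 𝕂 (tau i) * (K 𝕂 i : U 𝕂))) := by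
  refine and_congr_right fun _ => ⟨fun h => ⟨?_, fun i => ?_⟩, fun ⟨hL, hB⟩ b => ?_⟩
  · have hmem : (↑(L 𝕂)⁻¹ : U 𝕂) ∈ Bc 𝕂 c := by
      simpa only [zpow_neg_one] using UzeroTheta_le_Bc c (L_zpow_mem_UzeroTheta (𝕂 := 𝕂) (-1))
    simpa only [coe_barB, barRetraction_L_inv, barU_L_inv, commute_iff_eq] using
      h ⟨_, hmem⟩
  · simpa only [coe_barB, barRetraction_B, barU_B hc] using h ⟨_, B_mem_Bc c i⟩
  · have hL' : Commute (ofU 𝕂 (↑(L 𝕂)⁻¹ : U 𝕂)) (ofUhat 𝕂 𝔛) :=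
      Commute.units_inv_left (u := Units.map (ofU 𝕂 : U 𝕂 →* Ucompl 𝕂) (L 𝕂)) hL
    let S := intertwinerSubring ((ofU 𝕂 : U 𝕂 →+* Ucompl 𝕂).comp (barRetraction hc))
      ((ofU 𝕂 : U 𝕂 →+* Ucompl 𝕂).comp (barU 𝕂)) (ofUhat 𝕂 𝔛)
    have hS {x : U 𝕂} : x ∈ S ↔
        ofU 𝕂 (barRetraction hc x) * ofUhat 𝕂 𝔛 = ofUhat 𝕂 𝔛 * ofU 𝕂 (barU 𝕂 x) := Iff.rfl
    refine hS.1 (mem_of_mem_Bc (c := c) (fun r => ?_) ?_ ?_ (fun i => ?_) b.2) <;> rw [hS]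
    · rw [barRetraction_algebraMap, barU_algebraMap, AlgHom.commutes]
      exact Algebra.commutes _ _
    · rw [barRetraction_L, barU_L]
      exact hL'.eq
    · rw [barRetraction_L_inv, barU_L_inv]
      exact hL.eq
    · rw [barRetraction_B, barU_B hc]
      exact hB i

/-! ### The explicit quasi K-matrix -/

lemma qbrace_succ (n : ℕ) : qbrace 𝕂 (n + 1) = qbrace 𝕂 n + q 𝕂 ^ (2 * n) :=
  Finset.sum_range_succ _ _

lemma qbrace_succ' (n : ℕ) : qbrace 𝕂 (n + 1) = q 𝕂 ^ 2 * qbrace 𝕂 n + 1 := by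
  rw [qbrace, Finset.sum_range_succ', qbrace, Finset.mul_sum, mul_zero, pow_zero]
  congr 1
  exact Finset.sum_congr rfl fun k _ => by rw [mul_add, mul_one, pow_add, mul_comm]

lemma qbrace_succ_ne_zero (n : ℕ) : qbrace 𝕂 (n + 1) ≠ 0 := by
  intro h
  have h2 : qbrace 𝕂 (n + 1) * (q 𝕂 ^ 2 - 1) = q 𝕂 ^ (2 * (n + 1)) - 1 := by
    simp only [qbrace, pow_mul, geom_sum_mul]
  rw [h, zero_mul, eq_comm, sub_eq_zero] at h2
  exact q_pow_ne_one 𝕂 (by omega) h2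

lemma E_pow_succ_mul_F_sub (i : Fin 2) (n : ℕ) :
    E 𝕂 i ^ (n + 1) * F 𝕂 i - F 𝕂 i * E 𝕂 i ^ (n + 1) =
      (qbrace 𝕂 (n + 1) * (q 𝕂 - (q 𝕂)⁻¹)⁻¹) •
        (E 𝕂 i ^ n * (K 𝕂 i : U 𝕂) - ↑(K 𝕂 i)⁻¹ * E 𝕂 i ^ n) := by
  induction n with
  | zero => simp [E_mul_F_sub, qbrace]
  | succ n ih =>
    have hK : (K 𝕂 i : U 𝕂) * E 𝕂 i ^ (n + 1) =
        q 𝕂 ^ (2 * (n + 1)) • (E 𝕂 i ^ (n + 1) * (K 𝕂 i : U 𝕂)) := by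
      have h := ((hasWeight_E (𝕂 := 𝕂) i i).pow (n + 1)).eq
      rw [cartan_self] at h
      exact_mod_cast h
    have hK' : E 𝕂 i * (↑(K 𝕂 i)⁻¹ * E 𝕂 i ^ n) =
        q 𝕂 ^ 2 • (↑(K 𝕂 i)⁻¹ * E 𝕂 i ^ (n + 1)) := by
      have h := (hasWeight_E (𝕂 := 𝕂) i i).inv_left.eq
      rw [pow_succ' (E 𝕂 i), ← mul_assoc, ← mul_assoc, h, cartan_self, smul_mul_assoc, smul_smul,
        zpow_neg, ← zpow_natCast, Nat.cast_ofNat, mul_inv_cancel₀ (zpow_ne_zero 2 (q_ne_zero 𝕂)),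
        one_smul]
    calc E 𝕂 i ^ (n + 2) * F 𝕂 i - F 𝕂 i * E 𝕂 i ^ (n + 2)
        = E 𝕂 i * (E 𝕂 i ^ (n + 1) * F 𝕂 i - F 𝕂 i * E 𝕂 i ^ (n + 1)) +
            (E 𝕂 i * F 𝕂 i - F 𝕂 i * E 𝕂 i) * E 𝕂 i ^ (n + 1) := by
          rw [pow_succ' _ (n + 1)]
          noncomm_ring
      _ = (qbrace 𝕂 (n + 1) * (q 𝕂 - (q 𝕂)⁻¹)⁻¹) • (E 𝕂 i ^ (n + 1) * (K 𝕂 i : U 𝕂) -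
              q 𝕂 ^ 2 • (↑(K 𝕂 i)⁻¹ * E 𝕂 i ^ (n + 1))) +
            (q 𝕂 - (q 𝕂)⁻¹)⁻¹ • (q 𝕂 ^ (2 * (n + 1)) • (E 𝕂 i ^ (n + 1) * (K 𝕂 i : U 𝕂)) -
              ↑(K 𝕂 i)⁻¹ * E 𝕂 i ^ (n + 1)) := by
          rw [ih, E_mul_F_sub, mul_smul_comm, mul_sub, ← mul_assoc, ← pow_succ', hK',
            smul_mul_assoc, sub_mul, hK]
      _ = ((qbrace 𝕂 (n + 1) + q 𝕂 ^ (2 * (n + 1))) * (q 𝕂 - (q 𝕂)⁻¹)⁻¹) •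
              (E 𝕂 i ^ (n + 1) * (K 𝕂 i : U 𝕂)) -
            ((q 𝕂 ^ 2 * qbrace 𝕂 (n + 1) + 1) * (q 𝕂 - (q 𝕂)⁻¹)⁻¹) •
              (↑(K 𝕂 i)⁻¹ * E 𝕂 i ^ (n + 1)) := by
          rw [smul_sub, smul_sub, smul_smul, smul_smul, sub_add_sub_comm, ← add_smul, ← add_smul]
          congr 2 <;> ring
      _ = _ := by rw [← qbrace_succ, ← qbrace_succ', smul_sub]

/-- The coefficient of `(E₁E₂)ⁿ` in the quasi K-matrix. -/
def quasiKCoeff (c : RatFunc 𝕂) (n : ℕ) : RatFunc 𝕂 :=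
  (q 𝕂 - (q 𝕂)⁻¹) ^ n / qbraceFactorial 𝕂 n * c ^ n

lemma quasiKCoeff_zero (c : RatFunc 𝕂) : quasiKCoeff c 0 = 1 := by
  simp [quasiKCoeff, qbraceFactorial]

lemma quasiKCoeff_succ (c : RatFunc 𝕂) (n : ℕ) :
    quasiKCoeff c (n + 1) * (qbrace 𝕂 (n + 1) * (q 𝕂 - (q 𝕂)⁻¹)⁻¹) = c * quasiKCoeff c n := by
  have hbrace := qbrace_succ_ne_zero (𝕂 := 𝕂) n
  have hq := q_sub_q_inv_ne_zero (𝕂 := 𝕂)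
  have hfact : qbraceFactorial 𝕂 n ≠ 0 :=
    Finset.prod_ne_zero_iff.2 fun k _ => qbrace_succ_ne_zero k
  have hfact_succ : qbraceFactorial 𝕂 (n + 1) = qbraceFactorial 𝕂 n * qbrace 𝕂 (n + 1) :=
    Finset.prod_range_succ _ _
  rw [quasiKCoeff, quasiKCoeff, hfact_succ]
  generalize q 𝕂 - (q 𝕂)⁻¹ = d at *
  field_simp
  ring

/-- The truncation `∑_{n < N}` of the explicit quasi K-matrix. -/
def quasiKTrunc (c : RatFunc 𝕂) (N : ℕ) : U 𝕂 :=
  ∑ n ∈ Finset.range N, quasiKCoeff c n • (E 𝕂 0 * E 𝕂 1) ^ n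

lemma E_mul_E_eq (i : Fin 2) : E 𝕂 0 * E 𝕂 1 = E 𝕂 i * E 𝕂 (tau i) := by
  fin_cases i
  exacts [rfl, (E_commute 0 1).eq]

lemma E_mul_E_pow_succ_mul_F_sub (i : Fin 2) (n : ℕ) :
    (E 𝕂 0 * E 𝕂 1) ^ (n + 1) * F 𝕂 i - F 𝕂 i * (E 𝕂 0 * E 𝕂 1) ^ (n + 1) =
      (qbrace 𝕂 (n + 1) * (q 𝕂 - (q 𝕂)⁻¹)⁻¹) •
        ((E 𝕂 0 * E 𝕂 1) ^ n * (E 𝕂 (tau i) * (K 𝕂 i : U 𝕂)) -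
          E 𝕂 (tau i) * ↑(K 𝕂 i)⁻¹ * (E 𝕂 0 * E 𝕂 1) ^ n) := by
  have hE := E_commute (𝕂 := 𝕂) i (tau i)
  have hF : Commute (E 𝕂 (tau i) ^ (n + 1)) (F 𝕂 i) := (E_commute_F (tau_ne i)).pow_left _
  have hK : Commute (K 𝕂 i : U 𝕂) (E 𝕂 (tau i)) := K_commute_E (tau_ne i).symm
  have hl : E 𝕂 i ^ n * (K 𝕂 i : U 𝕂) * E 𝕂 (tau i) ^ (n + 1) =
      (E 𝕂 0 * E 𝕂 1) ^ n * (E 𝕂 (tau i) * (K 𝕂 i : U 𝕂)) := by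
    rw [mul_assoc, (hK.pow_right _).eq, pow_succ, E_mul_E_eq i, hE.mul_pow]
    simp only [mul_assoc]
  have hr : ↑(K 𝕂 i)⁻¹ * E 𝕂 i ^ n * E 𝕂 (tau i) ^ (n + 1) =
      E 𝕂 (tau i) * ↑(K 𝕂 i)⁻¹ * (E 𝕂 0 * E 𝕂 1) ^ n := by
    rw [← hK.units_inv_left.eq, pow_succ', mul_assoc, ← mul_assoc (E 𝕂 i ^ n),
      (hE.pow_left n).eq, E_mul_E_eq i, hE.mul_pow]
    simp only [mul_assoc]
  rw [E_mul_E_eq i, hE.mul_pow, mul_assoc, hF.eq, ← mul_assoc, ← mul_assoc, ← sub_mul,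
    E_pow_succ_mul_F_sub, smul_mul_assoc, sub_mul, hl, hr, E_mul_E_eq i]

lemma quasiKTrunc_succ_mul_F_sub (c : RatFunc 𝕂) (i : Fin 2) (N : ℕ) :
    quasiKTrunc c (N + 1) * F 𝕂 i - F 𝕂 i * quasiKTrunc c (N + 1) =
      c • (quasiKTrunc c N * (E 𝕂 (tau i) * (K 𝕂 i : U 𝕂)) -
          E 𝕂 (tau i) * ↑(K 𝕂 i)⁻¹ * quasiKTrunc c N) := by
  rw [quasiKTrunc, Finset.sum_range_succ', mul_add, add_mul, pow_zero, mul_smul_comm,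
    smul_mul_assoc, mul_one, one_mul, add_sub_add_right_eq_sub, Finset.mul_sum, Finset.sum_mul,
    ← Finset.sum_sub_distrib, quasiKTrunc, Finset.mul_sum, Finset.sum_mul,
    ← Finset.sum_sub_distrib, Finset.smul_sum]
  refine Finset.sum_congr rfl fun n _ => ?_
  rw [mul_smul_comm, smul_mul_assoc, ← smul_sub, E_mul_E_pow_succ_mul_F_sub, smul_smul,
    quasiKCoeff_succ, mul_smul_comm, smul_mul_assoc, ← smul_sub, smul_smul]

lemma L_commute_quasiKTrunc (c : RatFunc 𝕂) (N : ℕ) :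
    Commute (L 𝕂 : U 𝕂) (quasiKTrunc c N) := by
  have h : Commute (L 𝕂 : U 𝕂) (E 𝕂 0 * E 𝕂 1) := hasWeight_zero_iff.1 <|
    hasWeight_L ((hasWeight_E 0 0).mul (hasWeight_E 0 1)) ((hasWeight_E 1 0).mul (hasWeight_E 1 1))
  exact Commute.sum_right _ _ _ fun n _ => (h.pow_right n).smul_right _

/-! ### Existence of the quasi K-matrix -/

/-- `E₁^{μ₁} E₂^{μ₂}`, which spans the weight space `U⁺_μ`. -/
def monomial (m : Fin 2 → ℕ) : U 𝕂 := E 𝕂 0 ^ m 0 * E 𝕂 1 ^ m 1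

lemma mem_UposWt_iff {m : Fin 2 → ℕ} {x : U 𝕂} :
    x ∈ UposWt 𝕂 m ↔ x ∈ Upos 𝕂 ∧ ∀ i, HasWeight 𝕂 (K 𝕂 i) (∑ j, cartan i j * m j) x :=
  and_congr_right fun _ => forall_congr' fun _ => hasWeight_iff_conj.symm

lemma hasWeight_monomial (i : Fin 2) (m : Fin 2 → ℕ) :
    HasWeight 𝕂 (K 𝕂 i) (∑ j, cartan i j * m j) (monomial m) := by
  rw [Fin.sum_univ_two]
  exact ((hasWeight_E i 0).pow (m 0)).mul ((hasWeight_E i 1).pow (m 1))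

lemma monomial_mem_UposWt (m : Fin 2 → ℕ) : monomial m ∈ UposWt 𝕂 m :=
  mem_UposWt_iff.2 ⟨mul_mem (pow_mem (Algebra.subset_adjoin (Set.mem_range_self 0)) _)
    (pow_mem (Algebra.subset_adjoin (Set.mem_range_self 1)) _), fun i => hasWeight_monomial i m⟩

lemma monomial_of_eq {m : Fin 2 → ℕ} (h : m 0 = m 1) :
    (monomial m : U 𝕂) = (E 𝕂 0 * E 𝕂 1) ^ m 0 := by
  rw [monomial, ← h, (E_commute 0 1).mul_pow]

/-- The explicit quasi K-matrix. -/
def quasiK (c : RatFunc 𝕂) : Uhat 𝕂 := fun m =>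
  ⟨if m 0 = m 1 then quasiKCoeff c (m 0) • (E 𝕂 0 * E 𝕂 1) ^ m 0 else 0, by
    split_ifs with h
    · exact Submodule.smul_mem _ _ (monomial_of_eq (𝕂 := 𝕂) h ▸ monomial_mem_UposWt m)
    · exact zero_mem _⟩

lemma coe_quasiK (c : RatFunc 𝕂) (m : Fin 2 → ℕ) : (quasiK c m : U 𝕂) =
    if m 0 = m 1 then quasiKCoeff c (m 0) • (E 𝕂 0 * E 𝕂 1) ^ m 0 else 0 := rfl

/-- The action of an element of `𝒰` on a module of `𝒪_int`. -/
def evalAt (M : IntModule 𝕂) : Ucompl 𝕂 →ₐ[RatFunc 𝕂] Module.End (RatFunc 𝕂) M.carrier :=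
  (Pi.evalAlgHom (RatFunc 𝕂) _ M).comp (Ucompl 𝕂).val

lemma evalAt_ofUhat (M : IntModule 𝕂) (a : Uhat 𝕂) (v : M.carrier) :
    evalAt M (ofUhat 𝕂 a) v = ∑ᶠ m, (a m : U 𝕂) • v := rfl

lemma mul_eq_mul_iff_evalAt {x y : U 𝕂} {a : Ucompl 𝕂} : ofU 𝕂 x * a = a * ofU 𝕂 y ↔
    ∀ (M : IntModule 𝕂) (v : M.carrier), x • evalAt M a v = evalAt M a (y • v) :=
  ⟨fun h M v => DFunLike.congr_fun (congrArg (evalAt M) h) v,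
    fun h => Subtype.ext (funext fun M => LinearMap.ext (h M))⟩

lemma exists_evalAt_quasiK_eq (c : RatFunc 𝕂) (M : IntModule 𝕂) :
    ∃ N₀ : ℕ, ∀ N ≥ N₀, ∀ v : M.carrier,
      evalAt M (ofUhat 𝕂 (quasiK c)) v = quasiKTrunc c N • v := by
  obtain ⟨N₀, hN₀⟩ := ((finite_support_action 𝕂 M).image fun m => m 0).bddAbove
  refine ⟨N₀ + 1, fun N hN v => ?_⟩
  let diag : ℕ ↪ (Fin 2 → ℕ) := ⟨fun n _ => n, fun _ _ h => congrFun h 0⟩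
  have hsupp : (Function.support fun m => (quasiK c m : U 𝕂) • v) ⊆
      (Finset.range N).map diag := fun m hm => by
    have hm0 : m 0 ≤ N₀ := hN₀ ⟨m, ⟨_, (quasiK c m).2, v, hm⟩, rfl⟩
    have hm1 : m 0 = m 1 := by
      by_contra h
      exact hm (by simp only [coe_quasiK, if_neg h, zero_smul])
    exact Finset.mem_coe.2 <| Finset.mem_map.2
      ⟨m 0, Finset.mem_range.2 (by omega), funext (Fin.forall_fin_two.2 ⟨rfl, hm1⟩)⟩
  rw [evalAt_ofUhat, finsum_eq_sum_of_support_subset _ hsupp, Finset.sum_map, quasiKTrunc,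
    Finset.sum_smul]
  exact Finset.sum_congr rfl fun n _ => congrArg (· • v) (if_pos rfl)

lemma isQuasiKMatrix_quasiK {c : Fin 2 → RatFunc 𝕂} (hc : IsParameter 𝕂 c) :
    IsQuasiKMatrix 𝕂 c (barB hc) (quasiK (c 0)) := by
  refine (isQuasiKMatrix_iff hc _).2 ⟨?_, mul_eq_mul_iff_evalAt.2 fun M v => ?_,
    fun i => mul_eq_mul_iff_evalAt.2 fun M v => ?_⟩
  · simp [coe_quasiK, quasiKCoeff_zero]
  · obtain ⟨N, hN⟩ := exists_evalAt_quasiK_eq (c 0) M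
    rw [hN N le_rfl, hN N le_rfl, smul_smul, smul_smul, (L_commute_quasiKTrunc _ N).eq]
  · obtain ⟨N, hN⟩ := exists_evalAt_quasiK_eq (c 0) M
    have h := congrArg (· • v) (quasiKTrunc_succ_mul_F_sub (c 0) i N)
    simp only [sub_smul, smul_assoc, mul_smul, smul_sub, B, hc.apply_eq_apply_zero i, ← hN N le_rfl,
      ← hN (N + 1) (Nat.le_succ N), map_sub, map_smul] at h ⊢
    rw [← neg_inj, neg_sub, neg_sub] at h
    rw [sub_eq_sub_iff_sub_eq_sub, h]

/-! ### The modules `V(N) ⊗ V(N)` -/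

variable (𝕂) in
/-- The quantum integer `[n] = (qⁿ - q⁻ⁿ) / (q - q⁻¹)`. -/
def qnum (n : ℤ) : RatFunc 𝕂 := (q 𝕂 ^ n - q 𝕂 ^ (-n)) / (q 𝕂 - (q 𝕂)⁻¹)

lemma qnum_zero : qnum 𝕂 0 = 0 := by
  rw [qnum, neg_zero, sub_self, zero_div]

lemma qnum_ne_zero {n : ℤ} (hn : n ≠ 0) : qnum 𝕂 n ≠ 0 := by
  refine div_ne_zero (fun h => hn ?_) q_sub_q_inv_ne_zero
  have := q_zpow_injective 𝕂 (sub_eq_zero.1 h)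
  omega

lemma qnum_mul_sub (a b : ℤ) : qnum 𝕂 a * qnum 𝕂 (b + 1) - qnum 𝕂 (a + 1) * qnum 𝕂 b =
    (q 𝕂 - (q 𝕂)⁻¹)⁻¹ * (q 𝕂 ^ (a - b) - (q 𝕂 ^ (a - b))⁻¹) := by
  have hq := q_ne_zero 𝕂
  have hd := q_sub_q_inv_ne_zero (𝕂 := 𝕂)
  have ha := zpow_ne_zero a hq
  have hb := zpow_ne_zero b hq
  have key : (q 𝕂 ^ a - (q 𝕂 ^ a)⁻¹) * (q 𝕂 ^ b * q 𝕂 - (q 𝕂 ^ b * q 𝕂)⁻¹) -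
      (q 𝕂 ^ a * q 𝕂 - (q 𝕂 ^ a * q 𝕂)⁻¹) * (q 𝕂 ^ b - (q 𝕂 ^ b)⁻¹) =
      (q 𝕂 - (q 𝕂)⁻¹) * (q 𝕂 ^ a / q 𝕂 ^ b - (q 𝕂 ^ a / q 𝕂 ^ b)⁻¹) := by
    field_simp
    ring
  simp only [qnum, zpow_neg, zpow_add₀ hq, zpow_sub₀ hq, zpow_one]
  rw [div_mul_div_comm, div_mul_div_comm, ← sub_div, key, mul_div_mul_left _ _ hd, inv_mul_eq_div]

/-- The simple root `αᵢ`. -/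
def simpleRoot (i : Fin 2) : Fin 2 → ℤ := Pi.single i 1

lemma simpleRoot_self (i : Fin 2) : simpleRoot i i = 1 := Pi.single_eq_same _ _

lemma simpleRoot_of_ne {i j : Fin 2} (h : j ≠ i) : simpleRoot i j = 0 := Pi.single_eq_of_ne h _

lemma cartan_eq_two_mul (i j : Fin 2) : cartan i j = 2 * simpleRoot j i := by
  obtain rfl | h := eq_or_ne i j
  · rw [cartan_self, simpleRoot_self, mul_one]
  · rw [cartan_of_ne h, simpleRoot_of_ne h, mul_zero]

/-- The functions on the root lattice. The type carries the parameter `N` of the `U`-module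
structure given to it below; the functions supported on the box `[0, N]²` then form a submodule
isomorphic to `V(N) ⊗ V(N)`, where `x` stands for the weight `(2x₁ - N, 2x₂ - N)`. -/
def LatticeFun (𝕂 : Type u) [Field 𝕂] (_N : ℤ) : Type u := (Fin 2 → ℤ) → RatFunc 𝕂

namespace LatticeFun

variable {N : ℤ}

instance : AddCommGroup (LatticeFun 𝕂 N) :=
  inferInstanceAs (AddCommGroup ((Fin 2 → ℤ) → RatFunc 𝕂))

instance : Module (RatFunc 𝕂) (LatticeFun 𝕂 N) :=
  inferInstanceAs (Module (RatFunc 𝕂) ((Fin 2 → ℤ) → RatFunc 𝕂))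

lemma sub_apply (f g : LatticeFun 𝕂 N) (x : Fin 2 → ℤ) : (f - g) x = f x - g x := rfl

lemma smul_apply (r : RatFunc 𝕂) (f : LatticeFun 𝕂 N) (x : Fin 2 → ℤ) : (r • f) x = r * f x := rfl

/-- The operator `f ↦ a · f(· + d)`. -/
def weightedShift (a : (Fin 2 → ℤ) → RatFunc 𝕂) (d : Fin 2 → ℤ) :
    Module.End (RatFunc 𝕂) (LatticeFun 𝕂 N) where
  toFun f x := a x * f (x + d)
  map_add' _ _ := funext fun _ => mul_add _ _ _
  map_smul' _ _ := funext fun _ => mul_left_comm _ _ _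

lemma weightedShift_apply (a : (Fin 2 → ℤ) → RatFunc 𝕂) (d : Fin 2 → ℤ) (f : LatticeFun 𝕂 N)
    (x : Fin 2 → ℤ) : weightedShift a d f x = a x * f (x + d) := rfl

lemma weightedShift_mul (a b : (Fin 2 → ℤ) → RatFunc 𝕂) (d e : Fin 2 → ℤ) :
    (weightedShift a d * weightedShift b e : Module.End (RatFunc 𝕂) (LatticeFun 𝕂 N)) =
      weightedShift (fun x => a x * b (x + d)) (d + e) :=
  LinearMap.ext fun f => funext fun x => by
    simp only [Module.End.mul_apply, weightedShift_apply, mul_assoc, add_assoc]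

lemma weightedShift_commute {a b : (Fin 2 → ℤ) → RatFunc 𝕂} {d e : Fin 2 → ℤ}
    (h : ∀ x, a x * b (x + d) = b x * a (x + e)) :
    Commute (weightedShift a d : Module.End (RatFunc 𝕂) (LatticeFun 𝕂 N)) (weightedShift b e) := by
  rw [commute_iff_eq, weightedShift_mul, weightedShift_mul, add_comm d, funext h]

variable (𝕂 N) in
/-- The action of `Eᵢ`. -/
def actE (i : Fin 2) : Module.End (RatFunc 𝕂) (LatticeFun 𝕂 N) :=
  weightedShift (fun x => qnum 𝕂 (N - x i + 1)) (-simpleRoot i)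

variable (𝕂 N) in
/-- The action of `Fᵢ`. -/
def actF (i : Fin 2) : Module.End (RatFunc 𝕂) (LatticeFun 𝕂 N) :=
  weightedShift (fun x => qnum 𝕂 (x i + 1)) (simpleRoot i)

variable (𝕂 N) in
/-- The action of `Kᵢ`. -/
def actK (i : Fin 2) : (Module.End (RatFunc 𝕂) (LatticeFun 𝕂 N))ˣ where
  val := weightedShift (fun x => q 𝕂 ^ (2 * x i - N)) 0
  inv := weightedShift (fun x => (q 𝕂 ^ (2 * x i - N))⁻¹) 0
  val_inv := LinearMap.ext fun f => funext fun x => by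
    simp only [weightedShift_mul, weightedShift_apply, add_zero, Module.End.one_apply,
      mul_inv_cancel₀ (zpow_ne_zero _ (q_ne_zero 𝕂)), one_mul]
  inv_val := LinearMap.ext fun f => funext fun x => by
    simp only [weightedShift_mul, weightedShift_apply, add_zero, Module.End.one_apply,
      inv_mul_cancel₀ (zpow_ne_zero _ (q_ne_zero 𝕂)), one_mul]

lemma hasWeight_weightedShift (i : Fin 2) (a : (Fin 2 → ℤ) → RatFunc 𝕂) (d : Fin 2 → ℤ) :
    HasWeight 𝕂 (actK 𝕂 N i) (-(2 * d i)) (weightedShift a d) := by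
  refine LinearMap.ext fun f => funext fun x => ?_
  have hexp : q 𝕂 ^ (2 * x i - N) = q 𝕂 ^ (-(2 * d i)) * q 𝕂 ^ (2 * (x i + d i) - N) := by
    rw [← zpow_add₀ (q_ne_zero 𝕂)]
    congr 1
    ring
  simp only [actK, smul_mul_assoc, LinearMap.smul_apply, weightedShift_mul, weightedShift_apply,
    smul_apply, zero_add, add_zero, Pi.add_apply, hexp]
  ring

lemma actE_mul_actF_sub (i : Fin 2) :
    actE 𝕂 N i * actF 𝕂 N i - actF 𝕂 N i * actE 𝕂 N i = (q 𝕂 - (q 𝕂)⁻¹)⁻¹ •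
      ((actK 𝕂 N i : Module.End (RatFunc 𝕂) (LatticeFun 𝕂 N)) - ↑(actK 𝕂 N i)⁻¹) := by
  refine LinearMap.ext fun f => funext fun x => ?_
  have hqnum := qnum_mul_sub (𝕂 := 𝕂) (x i) (N - x i)
  rw [show x i - (N - x i) = 2 * x i - N by ring] at hqnum
  simp only [actE, actF, actK, Units.inv_mk, weightedShift_mul, LinearMap.sub_apply,
    LinearMap.smul_apply, weightedShift_apply, sub_apply, smul_apply, Pi.add_apply, Pi.neg_apply,
    simpleRoot_self, neg_add_cancel, add_neg_cancel, add_zero, neg_add_cancel_right,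
    sub_add_eq_sub_sub, sub_add_cancel]
  linear_combination f x * hqnum

variable (𝕂 N) in
/-- The operators by which `U` acts on `LatticeFun 𝕂 N`. -/
def generators : ChevalleyGenerators 𝕂 (Module.End (RatFunc 𝕂) (LatticeFun 𝕂 N)) where
  E := actE 𝕂 N
  F := actF 𝕂 N
  K := actK 𝕂 N
  K_commute := Units.ext (weightedShift_commute fun x => by simp only [add_zero, mul_comm]).eq
  hasWeight_E i j := by
    have h := hasWeight_weightedShift (N := N) i (fun x => qnum 𝕂 (N - x j + 1)) (-simpleRoot j)
    rwa [Pi.neg_apply, mul_neg, neg_neg, ← cartan_eq_two_mul] at h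
  hasWeight_F i j := cartan_eq_two_mul i j ▸ hasWeight_weightedShift i _ _
  E_mul_F_sub := actE_mul_actF_sub
  E_commute_F i j h := weightedShift_commute fun x => by
    simp [simpleRoot_of_ne h, simpleRoot_of_ne h.symm, mul_comm]
  E_commute := weightedShift_commute fun x => by simp [simpleRoot_of_ne, mul_comm]
  F_commute := weightedShift_commute fun x => by simp [simpleRoot_of_ne, mul_comm]

instance : Module (U 𝕂) (LatticeFun 𝕂 N) :=
  Module.compHom _ ((generators 𝕂 N).hom : U 𝕂 →+* Module.End (RatFunc 𝕂) (LatticeFun 𝕂 N))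

instance : IsScalarTower (RatFunc 𝕂) (U 𝕂) (LatticeFun 𝕂 N) where
  smul_assoc r x f := DFunLike.congr_fun (map_smul (generators 𝕂 N).hom r x) f

lemma ofGen_smul (g : Gen) (f : LatticeFun 𝕂 N) :
    ofGen 𝕂 g • f = (generators 𝕂 N).ofGen g f :=
  DFunLike.congr_fun ((generators 𝕂 N).hom_ofGen g) f

lemma E_smul_apply (i : Fin 2) (f : LatticeFun 𝕂 N) (x : Fin 2 → ℤ) :
    (E 𝕂 i • f) x = qnum 𝕂 (N - x i + 1) * f (x - simpleRoot i) :=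
  (congrFun (ofGen_smul (.E i) f) x).trans (by rw [sub_eq_add_neg]; rfl)

lemma F_smul_apply (i : Fin 2) (f : LatticeFun 𝕂 N) (x : Fin 2 → ℤ) :
    (F 𝕂 i • f) x = qnum 𝕂 (x i + 1) * f (x + simpleRoot i) :=
  congrFun (ofGen_smul (.F i) f) x

lemma K_smul_apply (i : Fin 2) (f : LatticeFun 𝕂 N) (x : Fin 2 → ℤ) :
    ((K 𝕂 i : U 𝕂) • f) x = q 𝕂 ^ (2 * x i - N) * f x :=
  (congrFun (ofGen_smul (.K i) f) x).trans (congrArg (_ * f ·) (add_zero x))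

lemma K_inv_smul_apply (i : Fin 2) (f : LatticeFun 𝕂 N) (x : Fin 2 → ℤ) :
    ((↑(K 𝕂 i)⁻¹ : U 𝕂) • f) x = (q 𝕂 ^ (2 * x i - N))⁻¹ * f x :=
  (congrFun (ofGen_smul (.Kinv i) f) x).trans (congrArg (_ * f ·) (add_zero x))

lemma mem_weightSpace_iff {n : Fin 2 → ℤ} {f : LatticeFun 𝕂 N} :
    f ∈ weightSpace 𝕂 (LatticeFun 𝕂 N) n ↔ ∀ x, f x ≠ 0 → ∀ i, n i = 2 * x i - N := by
  refine ⟨fun h x hx i => ?_, fun h i => funext fun x => ?_⟩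
  · have hK := congrFun (h i) x
    rw [K_smul_apply, smul_apply] at hK
    exact (q_zpow_injective 𝕂 (mul_right_cancel₀ hx hK)).symm
  · rw [K_smul_apply, smul_apply]
    by_cases hx : f x = 0
    · rw [hx, mul_zero, mul_zero]
    · rw [h x hx i]

/-- The function with value `r` at `x` that vanishes elsewhere. -/
def single (x : Fin 2 → ℤ) (r : RatFunc 𝕂) : LatticeFun 𝕂 N :=
  (Pi.single x r : (Fin 2 → ℤ) → RatFunc 𝕂)

lemma single_self (x : Fin 2 → ℤ) (r : RatFunc 𝕂) : (single x r : LatticeFun 𝕂 N) x = r :=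
  Pi.single_eq_same _ _

lemma single_of_ne {x y : Fin 2 → ℤ} (h : y ≠ x) (r : RatFunc 𝕂) :
    (single x r : LatticeFun 𝕂 N) y = 0 :=
  Pi.single_eq_of_ne h _

end LatticeFun

lemma smul_mem_of_forall_ofGen_smul_mem {M : Type*} [AddCommGroup M] [Module (RatFunc 𝕂) M]
    [Module (U 𝕂) M] [IsScalarTower (RatFunc 𝕂) (U 𝕂) M] {W : Submodule (RatFunc 𝕂) M}
    (hW : ∀ g, ∀ v ∈ W, ofGen 𝕂 g • v ∈ W) (x : U 𝕂) {v : M} (hv : v ∈ W) : x • v ∈ W := by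
  obtain ⟨a, rfl⟩ := RingQuot.mkAlgHom_surjective (RatFunc 𝕂) (Rel 𝕂) x
  change proj 𝕂 a • v ∈ W
  induction a using FreeAlgebra.induction generalizing v with
  | grade0 r =>
    rw [AlgHom.commutes, algebraMap_smul]
    exact W.smul_mem r hv
  | grade1 g => exact hW g v hv
  | mul a b ha hb =>
    rw [map_mul, mul_smul]
    exact ha (hb hv)
  | add a b ha hb =>
    rw [map_add, add_smul]
    exact add_mem (ha hv) (hb hv)

variable (𝕂) in
/-- The functions supported on the box `[0, N]²`, as a subspace; see `boxModule`. -/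
def boxSubspace (N : ℤ) : Submodule (RatFunc 𝕂) (LatticeFun 𝕂 N) where
  carrier := {f | ∀ x, f x ≠ 0 → ∀ i, 0 ≤ x i ∧ x i ≤ N}
  zero_mem' x hx := (hx rfl).elim
  add_mem' {f g} hf hg x hx := by
    by_cases h : f x = 0
    · exact hg x fun h' => hx ((congrArg₂ _ h h').trans (add_zero 0))
    · exact hf x h
  smul_mem' _ _ hf x hx := hf x (right_ne_zero_of_mul hx)

lemma E_smul_mem_boxSubspace {N : ℤ} (i : Fin 2) {f : LatticeFun 𝕂 N} (hf : f ∈ boxSubspace 𝕂 N) :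
    E 𝕂 i • f ∈ boxSubspace 𝕂 N := by
  intro x hx j
  rw [LatticeFun.E_smul_apply] at hx
  have hxi : N - x i + 1 ≠ 0 := fun h => left_ne_zero_of_mul hx (by rw [h, qnum_zero])
  have hbox := hf _ (right_ne_zero_of_mul hx) j
  obtain rfl | hj := eq_or_ne j i
  · rw [Pi.sub_apply, simpleRoot_self] at hbox
    omega
  · rwa [Pi.sub_apply, simpleRoot_of_ne hj, sub_zero] at hbox

lemma F_smul_mem_boxSubspace {N : ℤ} (i : Fin 2) {f : LatticeFun 𝕂 N} (hf : f ∈ boxSubspace 𝕂 N) :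
    F 𝕂 i • f ∈ boxSubspace 𝕂 N := by
  intro x hx j
  rw [LatticeFun.F_smul_apply] at hx
  have hxi : x i + 1 ≠ 0 := fun h => left_ne_zero_of_mul hx (by rw [h, qnum_zero])
  have hbox := hf _ (right_ne_zero_of_mul hx) j
  obtain rfl | hj := eq_or_ne j i
  · rw [Pi.add_apply, simpleRoot_self] at hbox
    omega
  · rwa [Pi.add_apply, simpleRoot_of_ne hj, add_zero] at hbox

lemma ofGen_smul_mem_boxSubspace {N : ℤ} (g : Gen) (f : LatticeFun 𝕂 N)
    (hf : f ∈ boxSubspace 𝕂 N) : ofGen 𝕂 g • f ∈ boxSubspace 𝕂 N := by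
  cases g with
  | E i => exact E_smul_mem_boxSubspace i hf
  | F i => exact F_smul_mem_boxSubspace i hf
  | K i => exact fun x hx => hf x (right_ne_zero_of_mul (LatticeFun.K_smul_apply i f x ▸ hx))
  | Kinv i =>
    exact fun x hx => hf x (right_ne_zero_of_mul (LatticeFun.K_inv_smul_apply i f x ▸ hx))

variable (𝕂) in
/-- The `U`-module `V(N) ⊗ V(N)`, realised on the functions supported on the box `[0, N]²`. -/
def boxModule (N : ℤ) : Submodule (U 𝕂) (LatticeFun 𝕂 N) where
  __ := boxSubspace 𝕂 N
  smul_mem' x _ hf := smul_mem_of_forall_ofGen_smul_mem ofGen_smul_mem_boxSubspace x hf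

section boxModule

variable {N : ℤ}

lemma boxModule_apply_eq_zero (f : boxModule 𝕂 N) {x : Fin 2 → ℤ}
    (hx : x ∉ Finset.Icc 0 (fun _ => N)) : f.1 x = 0 := by
  by_contra h
  have hbox := f.2 x h
  exact hx (Finset.mem_Icc.2 ⟨fun i => (hbox i).1, fun i => (hbox i).2⟩)

instance : Module.Finite (RatFunc 𝕂) (boxModule 𝕂 N) := by
  let restrict : LatticeFun 𝕂 N →ₗ[RatFunc 𝕂] (Finset.Icc (0 : Fin 2 → ℤ) fun _ => N) → RatFunc 𝕂 :=
    LinearMap.funLeft _ _ Subtype.val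
  refine Module.Finite.of_injective
    (restrict ∘ₗ (boxModule 𝕂 N).subtype.restrictScalars (RatFunc 𝕂))
    fun f g h => Subtype.ext (funext fun x => ?_)
  by_cases hx : x ∈ Finset.Icc 0 (fun _ => N)
  · exact congrFun h ⟨x, hx⟩
  · rw [boxModule_apply_eq_zero f hx, boxModule_apply_eq_zero g hx]

/-- The function that agrees with `f` at `x` and vanishes elsewhere. -/
def boxModulePart (f : boxModule 𝕂 N) (x : Fin 2 → ℤ) : boxModule 𝕂 N :=
  ⟨LatticeFun.single x (f.1 x), fun y hy => f.2 y <| by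
    obtain rfl | h := eq_or_ne y x
    · rwa [LatticeFun.single_self] at hy
    · exact (hy (LatticeFun.single_of_ne h _)).elim⟩

lemma sum_boxModulePart (f : boxModule 𝕂 N) :
    ∑ x ∈ Finset.Icc 0 (fun _ => N), boxModulePart f x = f := by
  refine Subtype.ext (funext fun y => ?_)
  refine (congrFun (AddSubmonoidClass.coe_finsetSum _ _) y).trans <|
    (Finset.sum_apply _ _ _).trans <| (Finset.sum_pi_single y f.1 _).trans ?_
  split_ifs with hy
  · rfl
  · exact (boxModule_apply_eq_zero f hy).symm

lemma mem_weightSpace_boxModule_iff {n : Fin 2 → ℤ} {f : boxModule 𝕂 N} :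
    f ∈ weightSpace 𝕂 (boxModule 𝕂 N) n ↔ f.1 ∈ weightSpace 𝕂 (LatticeFun 𝕂 N) n :=
  forall_congr' fun _ => Subtype.ext_iff

lemma boxModulePart_mem_weightSpace (f : boxModule 𝕂 N) (x : Fin 2 → ℤ) :
    boxModulePart f x ∈ weightSpace 𝕂 (boxModule 𝕂 N) (fun i => 2 * x i - N) := by
  refine mem_weightSpace_boxModule_iff.2 (LatticeFun.mem_weightSpace_iff.2 fun y hy i => ?_)
  obtain rfl | h := eq_or_ne y x
  · rfl
  · exact (hy (LatticeFun.single_of_ne (N := N) h _)).elim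

variable (𝕂 N) in
/-- `boxModule 𝕂 N` as an object of `𝒪_int`. -/
abbrev boxIntModule : IntModule 𝕂 where
  carrier := boxModule 𝕂 N
  type_one := (Submodule.eq_top_iff'.2 fun f => sum_boxModulePart f ▸ Submodule.sum_mem _ fun x _ =>
    Submodule.mem_iSup_of_mem _ (boxModulePart_mem_weightSpace f x))

end boxModule

/-! ### The action of `U⁺` on lowest weight vectors -/

lemma monomial_mul (m n : Fin 2 → ℕ) : (monomial m * monomial n : U 𝕂) = monomial (m + n) := by
  simp only [monomial, Pi.add_apply, pow_add]
  exact ((E_commute 1 0).pow_pow _ _).mul_mul_mul_comm _ _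

lemma Upos_le_span_monomial :
    Subalgebra.toSubmodule (Upos 𝕂) ≤ Submodule.span (RatFunc 𝕂) (Set.range monomial) := by
  rw [Upos, Algebra.adjoin_eq_span]
  refine Submodule.span_mono fun y hy => ?_
  induction hy using Submonoid.closure_induction with
  | mem y hy =>
    obtain ⟨i, rfl⟩ := hy
    refine ⟨Pi.single i 1, ?_⟩
    fin_cases i <;> simp [monomial]
  | one => exact ⟨0, by simp [monomial]⟩
  | mul y z _ _ hy hz =>
    obtain ⟨m, rfl⟩ := hy
    obtain ⟨n, rfl⟩ := hz
    exact ⟨m + n, (monomial_mul m n).symm⟩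

lemma E_commute_of_mem_Upos (i : Fin 2) {x : U 𝕂} (hx : x ∈ Upos 𝕂) : Commute (E 𝕂 i) x := by
  have h : Upos 𝕂 ≤ Subalgebra.centralizer (RatFunc 𝕂) {E 𝕂 i} :=
    Algebra.adjoin_le <| Set.range_subset_iff.2 fun j =>
      Subalgebra.mem_centralizer_iff _ |>.2 fun _ hy => hy ▸ (E_commute i j).eq
  exact Subalgebra.mem_centralizer_iff _ |>.1 (h hx) _ rfl

lemma smul_mem_weightSpace {M : Type u} [AddCommGroup M] [Module (RatFunc 𝕂) M] [Module (U 𝕂) M]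
    [IsScalarTower (RatFunc 𝕂) (U 𝕂) M] {m : Fin 2 → ℕ} {x : U 𝕂} (hx : x ∈ UposWt 𝕂 m)
    {n : Fin 2 → ℤ} {v : M} (hv : v ∈ weightSpace 𝕂 M n) :
    x • v ∈ weightSpace 𝕂 M (fun i => 2 * m i + n i) := by
  intro i
  have hcartan : ∑ j, cartan i j * (m j : ℤ) = 2 * m i := by
    fin_cases i <;> simp [cartan]
  have hxv : x • q 𝕂 ^ n i • v = q 𝕂 ^ n i • x • v := smul_algebra_smul_comm _ _ _
  rw [smul_smul, ((mem_UposWt_iff.1 hx).2 i).eq, smul_assoc, mul_smul, hv i, hxv, smul_smul,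
    hcartan, ← zpow_add₀ (q_ne_zero 𝕂)]

variable (𝕂) in
/-- The lowest weight vector of `boxModule 𝕂 N`. -/
def lowestVector (N : ℕ) : boxModule 𝕂 N :=
  ⟨LatticeFun.single 0 1, fun x hx i => by
    obtain rfl | h := eq_or_ne x 0
    · exact ⟨le_rfl, N.cast_nonneg⟩
    · exact (hx (LatticeFun.single_of_ne h _)).elim⟩

section lowestVector

variable {N : ℕ}

lemma lowestVector_apply_zero : (lowestVector 𝕂 N).1 0 = 1 :=
  LatticeFun.single_self (N := N) 0 1

lemma lowestVector_apply_of_ne {x : Fin 2 → ℤ} (hx : x ≠ 0) : (lowestVector 𝕂 N).1 x = 0 :=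
  LatticeFun.single_of_ne (N := N) hx 1

lemma lowestVector_mem_weightSpace :
    lowestVector 𝕂 N ∈ weightSpace 𝕂 (boxModule 𝕂 N) (fun _ => -N) := by
  refine mem_weightSpace_boxModule_iff.2 (LatticeFun.mem_weightSpace_iff.2 fun x hx i => ?_)
  obtain rfl : x = 0 := by_contra fun h => hx (lowestVector_apply_of_ne h)
  simp

lemma F_smul_lowestVector (i : Fin 2) : F 𝕂 i • lowestVector 𝕂 N = 0 := by
  refine Subtype.ext (funext fun x => (LatticeFun.F_smul_apply i _ x).trans ?_)
  by_cases hx : x + simpleRoot i = 0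
  · have hxi : x i + 1 = 0 := by simpa [simpleRoot_self] using congrFun hx i
    rw [hxi, qnum_zero, zero_mul]
    rfl
  · rw [lowestVector_apply_of_ne hx, mul_zero]
    rfl

lemma smul_lowestVector_apply_of_ne {m : Fin 2 → ℕ} {x : U 𝕂} (hx : x ∈ UposWt 𝕂 m)
    {y : Fin 2 → ℤ} (hy : y ≠ fun i => (m i : ℤ)) : (x • lowestVector 𝕂 N).1 y = 0 := by
  by_contra h
  have hwt := LatticeFun.mem_weightSpace_iff.1
    (mem_weightSpace_boxModule_iff.1 (smul_mem_weightSpace hx lowestVector_mem_weightSpace)) y h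
  exact hy (funext fun i => by have := hwt i; omega)

lemma E_pow_smul_apply_ne_zero {N : ℤ} {f : LatticeFun 𝕂 N} {x : Fin 2 → ℤ} (hf : f x ≠ 0)
    (i : Fin 2) {n : ℕ} (hn : x i + n ≤ N) : (E 𝕂 i ^ n • f) (x + n • simpleRoot i) ≠ 0 := by
  induction n with
  | zero => simpa using hf
  | succ n ih =>
    push_cast at hn
    have hx : N - (x + (n + 1) • simpleRoot i) i + 1 ≠ 0 := by
      rw [Pi.add_apply, Pi.smul_apply, simpleRoot_self, nsmul_one]
      omega
    rw [pow_succ', mul_smul, LatticeFun.E_smul_apply, succ_nsmul, ← add_assoc,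
      add_sub_cancel_right]
    rw [succ_nsmul, ← add_assoc] at hx
    exact mul_ne_zero (qnum_ne_zero hx) (ih (by omega))

lemma monomial_smul_lowestVector_apply_ne_zero {m : Fin 2 → ℕ} (hm : ∀ i, m i ≤ N) :
    ((monomial m : U 𝕂) • lowestVector 𝕂 N).1 (fun i => (m i : ℤ)) ≠ 0 := by
  have h0 : (lowestVector 𝕂 N).1 0 ≠ 0 := lowestVector_apply_zero.trans_ne one_ne_zero
  have h1 := E_pow_smul_apply_ne_zero h0 1 (n := m 1) (by simpa using hm 1)
  have h2 := E_pow_smul_apply_ne_zero h1 0 (n := m 0) (by simpa [simpleRoot_of_ne] using hm 0)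
  have hx : (0 : Fin 2 → ℤ) + m 1 • simpleRoot 1 + m 0 • simpleRoot 0 = fun i => (m i : ℤ) :=
    funext (Fin.forall_fin_two.2 ⟨by simp [simpleRoot_self, simpleRoot_of_ne],
      by simp [simpleRoot_self, simpleRoot_of_ne]⟩)
  rwa [hx, smul_smul] at h2

lemma eq_zero_of_forall_smul_lowestVector_eq_zero {x : U 𝕂} (hx : x ∈ Upos 𝕂)
    (h : ∀ N, x • lowestVector 𝕂 N = 0) : x = 0 := by
  obtain ⟨s, rfl⟩ := Finsupp.mem_span_range_iff_exists_finsupp.1 (Upos_le_span_monomial hx)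
  suffices hs : s = 0 by rw [hs, Finsupp.sum_zero_index]
  ext y
  by_contra hy
  let N := y 0 + y 1
  have hyN : ∀ i, y i ≤ N := Fin.forall_fin_two.2 ⟨Nat.le_add_right _ _, Nat.le_add_left _ _⟩
  let coord : boxModule 𝕂 N →ₗ[RatFunc 𝕂] RatFunc 𝕂 :=
    { toFun f := f.1 fun i => (y i : ℤ), map_add' _ _ := rfl, map_smul' _ _ := rfl }
  have hcoord : s y * coord ((monomial y : U 𝕂) • lowestVector 𝕂 N) = 0 := by
    have h := congrArg coord (h N)
    rw [Finsupp.sum, Finset.sum_smul, map_sum, map_zero] at h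
    simp only [smul_assoc, map_smul] at h
    rwa [Finset.sum_eq_single_of_mem y (Finsupp.mem_support_iff.2 hy) fun m _ hm => by
      rw [show coord _ = 0 from smul_lowestVector_apply_of_ne (monomial_mem_UposWt m) fun h =>
        hm (funext fun i => by exact_mod_cast (congrFun h i).symm), smul_zero]] at h
  exact mul_ne_zero hy (monomial_smul_lowestVector_apply_ne_zero hyN) hcoord

end lowestVector

/-! ### Uniqueness of the quasi K-matrix -/

lemma eq_zero_of_recurrence {R : Type*} [MulZeroClass R] [NoZeroDivisors R]
    {f : (Fin 2 → ℤ) → R} {a b : Fin 2 → (Fin 2 → ℤ) → R} (hneg : ∀ x i, x i < 0 → f x = 0)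
    (hzero : f 0 = 0) (ha : ∀ i x, 0 ≤ x i → a i x ≠ 0)
    (hrec : ∀ i x, a i x * f (x + simpleRoot i) = b i x * f (x - simpleRoot (tau i)))
    (x : Fin 2 → ℤ) : f x = 0 := by
  suffices h : ∀ n : ℕ, ∀ x : Fin 2 → ℤ, x 0 + x 1 < n → f x = 0 from
    h (x 0 + x 1 + 1).toNat x (by omega)
  intro n
  induction n with
  | zero =>
    intro x hx
    obtain h | h : x 0 < 0 ∨ x 1 < 0 := by omega
    exacts [hneg x 0 h, hneg x 1 h]
  | succ n ih =>
    intro x hx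
    by_cases hpos : ∃ i, 0 < x i
    · obtain ⟨i, hi⟩ := hpos
      have hlt : (x - simpleRoot i - simpleRoot (tau i)) 0 +
          (x - simpleRoot i - simpleRoot (tau i)) 1 < n := by
        have hsum (j : Fin 2) : simpleRoot j 0 + simpleRoot j 1 = 1 := by
          fin_cases j <;> simp [simpleRoot]
        have h := hsum i
        have h' := hsum (tau i)
        simp only [Pi.sub_apply]
        omega
      have h := hrec i (x - simpleRoot i)
      rw [ih _ hlt, mul_zero, sub_add_cancel] at h
      refine (mul_eq_zero.1 h).resolve_left (ha i _ ?_)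
      rw [Pi.sub_apply, simpleRoot_self]
      omega
    · by_cases hx0 : x = 0
      · rw [hx0, hzero]
      · push Not at hpos
        obtain ⟨i, hi⟩ := Function.ne_iff.1 hx0
        exact hneg x i (lt_of_le_of_ne (hpos i) hi)

lemma evalAt_ofUhat_E_smul (a : Uhat 𝕂) (M : IntModule 𝕂) (i : Fin 2) (v : M.carrier) :
    evalAt M (ofUhat 𝕂 a) (E 𝕂 i • v) = E 𝕂 i • evalAt M (ofUhat 𝕂 a) v := by
  rw [evalAt_ofUhat, evalAt_ofUhat, smul_finsum' _ (finite_support_smul 𝕂 M a v)]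
  exact finsum_congr fun m => by
    rw [smul_smul, smul_smul, (E_commute_of_mem_Upos i (a m).2.1).eq]

lemma IsQuasiKMatrix.F_smul_evalAt {c : Fin 2 → RatFunc 𝕂} {hc : IsParameter 𝕂 c} {a : Uhat 𝕂}
    (ha : IsQuasiKMatrix 𝕂 c (barB hc) a) {M : IntModule 𝕂} {n : Fin 2 → ℤ} {v : M.carrier}
    (hv : v ∈ weightSpace 𝕂 M.carrier n) {i : Fin 2} (hFv : F 𝕂 i • v = 0) :
    F 𝕂 i • evalAt M (ofUhat 𝕂 a) v =
      c i • E 𝕂 (tau i) • ((↑(K 𝕂 i)⁻¹ : U 𝕂) • evalAt M (ofUhat 𝕂 a) v -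
        q 𝕂 ^ n i • evalAt M (ofUhat 𝕂 a) v) := by
  have h := mul_eq_mul_iff_evalAt.1 (((isQuasiKMatrix_iff hc a).1 ha).2.2 i) M v
  rw [B, sub_smul, sub_smul, hFv, zero_sub, smul_assoc, smul_assoc, mul_smul, mul_smul, hv i,
    map_neg, map_smul, evalAt_ofUhat_E_smul, map_smul, sub_eq_iff_eq_add] at h
  rw [h, smul_sub, smul_sub]
  abel

lemma boxModule_eq_zero_of_F_smul_eq {N : ℤ} {c r : Fin 2 → RatFunc 𝕂} {f : boxModule 𝕂 N}
    (hzero : f.1 0 = 0) (hF : ∀ i, F 𝕂 i • f =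
      c i • E 𝕂 (tau i) • ((↑(K 𝕂 i)⁻¹ : U 𝕂) • f - r i • f)) : f = 0 := by
  refine Subtype.ext (funext (eq_zero_of_recurrence
    (a := fun i x => qnum 𝕂 (x i + 1))
    (b := fun i x => c i * (qnum 𝕂 (N - x (tau i) + 1) *
      ((q 𝕂 ^ (2 * (x - simpleRoot (tau i)) i - N))⁻¹ - r i)))
    (fun x i hx => ?_) hzero (fun i x hx => qnum_ne_zero (by omega)) fun i x => ?_))
  · exact boxModule_apply_eq_zero f fun h => not_le.2 hx ((Finset.mem_Icc.1 h).1 i)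
  · have h := congrFun (congrArg Subtype.val (hF i)) x
    change (F 𝕂 i • f.1) x =
      c i * (E 𝕂 (tau i) • ((↑(K 𝕂 i)⁻¹ : U 𝕂) • f.1 - r i • f.1) : LatticeFun 𝕂 N) x at h
    rw [LatticeFun.F_smul_apply, LatticeFun.E_smul_apply, LatticeFun.sub_apply,
      LatticeFun.K_inv_smul_apply, LatticeFun.smul_apply] at h
    rw [h]
    ring

lemma evalAt_ofUhat_lowestVector_apply (a : Uhat 𝕂) (N : ℕ) (m : Fin 2 → ℕ) :
    (evalAt (boxIntModule 𝕂 N) (ofUhat 𝕂 a) (lowestVector 𝕂 N)).1 (fun i => (m i : ℤ)) =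
      ((a m : U 𝕂) • lowestVector 𝕂 N).1 fun i => (m i : ℤ) := by
  let coord : boxModule 𝕂 N →+ RatFunc 𝕂 :=
    { toFun f := f.1 fun i => (m i : ℤ), map_zero' := rfl, map_add' _ _ := rfl }
  rw [evalAt_ofUhat]
  refine (coord.map_finsum (finite_support_smul 𝕂 (boxIntModule 𝕂 N) a _)).trans <|
    finsum_eq_single _ m fun n hn => smul_lowestVector_apply_of_ne (a n).2 fun h => hn ?_
  exact funext fun i => by exact_mod_cast (congrFun h i).symm

lemma IsQuasiKMatrix.evalAt_lowestVector_eq {c : Fin 2 → RatFunc 𝕂} {hc : IsParameter 𝕂 c}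
    {a b : Uhat 𝕂} (ha : IsQuasiKMatrix 𝕂 c (barB hc) a) (hb : IsQuasiKMatrix 𝕂 c (barB hc) b)
    (N : ℕ) : evalAt (boxIntModule 𝕂 N) (ofUhat 𝕂 a) (lowestVector 𝕂 N) =
      evalAt (boxIntModule 𝕂 N) (ofUhat 𝕂 b) (lowestVector 𝕂 N) := by
  refine sub_eq_zero.1 (boxModule_eq_zero_of_F_smul_eq (c := c) (r := fun _ => q 𝕂 ^ (-N : ℤ))
    ?_ fun i => ?_)
  · have h := (evalAt_ofUhat_lowestVector_apply a N 0).trans (by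
      rw [ha.1, ← hb.1, ← evalAt_ofUhat_lowestVector_apply b N 0])
    exact sub_eq_zero.2 h
  · rw [smul_sub (F 𝕂 i), ha.F_smul_evalAt lowestVector_mem_weightSpace (F_smul_lowestVector i),
      hb.F_smul_evalAt lowestVector_mem_weightSpace (F_smul_lowestVector i), ← smul_sub,
      ← smul_sub, smul_sub (↑(K 𝕂 i)⁻¹ : U 𝕂), smul_sub (q 𝕂 ^ _), sub_sub_sub_comm]

lemma IsQuasiKMatrix.unique {c : Fin 2 → RatFunc 𝕂} {hc : IsParameter 𝕂 c} {a b : Uhat 𝕂}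
    (ha : IsQuasiKMatrix 𝕂 c (barB hc) a) (hb : IsQuasiKMatrix 𝕂 c (barB hc) b) : a = b := by
  refine funext fun m => Subtype.ext (sub_eq_zero.1 ?_)
  refine eq_zero_of_forall_smul_lowestVector_eq_zero (sub_mem (a m).2.1 (b m).2.1) fun N => ?_
  refine Subtype.ext (funext fun y => ?_)
  by_cases hy : y = fun i => (m i : ℤ)
  · rw [hy, sub_smul]
    refine sub_eq_zero.2 ?_
    rw [← evalAt_ofUhat_lowestVector_apply, ha.evalAt_lowestVector_eq hb,
      evalAt_ofUhat_lowestVector_apply]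
  · exact smul_lowestVector_apply_of_ne (sub_mem (a m).2 (b m).2) hy

end AIII11

end

open AIII11 in
theorem mainTheorem9_general (𝕂 : Type u) [Field 𝕂] (c : Fin 2 → RatFunc 𝕂)
    (hc : IsParameter 𝕂 c) :
    ∃ φ : Bc 𝕂 c ≃ₐ[𝕂] Bc 𝕂 c,
      (∀ ψ : Bc 𝕂 c ≃ₐ[𝕂] Bc 𝕂 c, IsBarInvolution 𝕂 c ψ ↔ ψ = φ) ∧
      ∃ 𝔛 : Uhat 𝕂,
        (∀ 𝔜 : Uhat 𝕂, IsQuasiKMatrix 𝕂 c φ 𝔜 ↔ 𝔜 = 𝔛) ∧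
        ∀ m : Fin 2 → ℕ, (𝔛 m : U 𝕂) =
          if m 0 = m 1 then
            ((q 𝕂 - (q 𝕂)⁻¹) ^ m 0 / qbraceFactorial 𝕂 (m 0) * c 0 ^ m 0) • (E 𝕂 0 * E 𝕂 1) ^ m 0
          else 0 :=
  ⟨barB hc, isBarInvolution_iff hc, quasiK (c 0),
    fun _ => ⟨fun h => h.unique (isQuasiKMatrix_quasiK hc), fun h => h ▸ isQuasiKMatrix_quasiK hc⟩,
    coe_quasiK (c 0)⟩

open AIII11 in
theorem mainTheorem9 (𝕂 : Type u) [Field 𝕂] [CharZero 𝕂] (c : Fin 2 → RatFunc 𝕂)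
    (hc : IsParameter 𝕂 c) :
    ∃ φ : Bc 𝕂 c ≃ₐ[𝕂] Bc 𝕂 c,
      (∀ ψ : Bc 𝕂 c ≃ₐ[𝕂] Bc 𝕂 c, IsBarInvolution 𝕂 c ψ ↔ ψ = φ) ∧
      ∃ 𝔛 : Uhat 𝕂,
        (∀ 𝔜 : Uhat 𝕂, IsQuasiKMatrix 𝕂 c φ 𝔜 ↔ 𝔜 = 𝔛) ∧
        ∀ m : Fin 2 → ℕ, (𝔛 m : U 𝕂) =
          if m 0 = m 1 then
            ((q 𝕂 - (q 𝕂)⁻¹) ^ m 0 / qbraceFactorial 𝕂 (m 0) * c 0 ^ m 0) • (E 𝕂 0 * E 𝕂 1) ^ m 0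
          else 0 :=
  mainTheorem9_general 𝕂 c hc
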